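/- Let $w=(w_k)_{k\ge 0}$ be real square-integrable random variables on a probability space $(\Omega,\mathcal F,\mathbb P)$, put $\mathcal F_{-1}=\{\emptyset,\Omega\}$ and $\mathcal F_k=\sigma(w_0,\dots,w_k)$, and assume $\mathbb E[w_k\mid\mathcal F_{k-1}]=0$ and $\mathbb E[w_k^2\mid\mathcal F_{k-1}]=1$ for all $k\ge 0$. Let $\rho\in\mathbb R$. Let $L^{2,\rho}_{\mathbb F}(\mathbb R^d)$ be the set of $\mathbb R^d$-valued processes $g=(g_k)_{k\ge0}$ with $g_k$ $\mathcal F_{k-1}$-measurable and $\mathbb E\sum_{k\ge0}e^{-\rho k}|g_k|^2<\infty$. Let $L^\infty_{\mathbb F}$ be the set of matrix-valued processes $A=(A_k)_{k\ge0}$ with $A_k$ $\mathcal F_{k-1}$-measurable and $\|A\|_\infty:=\sup_k\operatorname{ess\,sup}_\omega|A_k(\omega)|<\infty$, where $|A|=\sqrt{\operatorname{tr}(AA^\top)}$. Let $A,C\in L^\infty_{\mathbb F}$ be $n\times n$-valued, $B,D\in L^\infty_{\mathbb F}$ be $n\times m$-valued, $b,\sigma\in L^{2,\rho}_{\mathbb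 F}(\mathbb R^n)$, $M\in\mathbb R^{n\times n}$ symmetric, and let $Q,R\in L^\infty_{\mathbb F}$ take symmetric $n\times n$, respectively $m\times m$, values. For a pair $(\xi,u)$ with $\xi\in L^2_{\mathcal F_{-1}}(\Omega;\mathbb R^n)$ and $u\in\mathbb U:=L^{2,\rho}_{\mathbb F}(\mathbb R^m)$ (an admissible pair), let $x$ be the state process given by $$x_{k+1}=A_kx_k+B_ku_k+b_k+(C_kx_k+D_ku_k+\sigma_k)w_k\quad(k\ge0),\qquad x_0=\xi,$$ and let $$J(\xi,u)=\tfrac12\,\mathbb E\Big\{\langle M\xi,\xi\rangle+\sum_{k=0}^\infty e^{-\rho k}\big[\langle Q_kx_k,x_k\rangle+\langle R_ku_k,u_k\rangle\big]\Big\}.$$ An admissible pair is optimal if it minimizes $J$ over all admissible pairs. For a process $y$ write $y'_{k+1}=\mathbb E[y_{k+1}\mid\mathcal F_{k-1}]$ and $z'_{k+1}=\mathbb E[y_{k+1}w_k\mid\mathcal F_{k-1}]$. The Hamiltonian system, for $\bar x,\bar y\in L^{2,\rho}_{\mathbb F}(\mathbb R^n)$ and $\bar u\in\mathbb U$, is (almost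 surely, for all $k\ge0$) $$\begin{aligned}\bar x_{k+1}&=A_k\bar x_k+B_k\bar u_k+b_k+(C_k\bar x_k+D_k\bar u_k+\sigma_k)w_k,\\ \bar y_k&=e^{-\rho}A_k^\top\bar y'_{k+1}+e^{-\rho}C_k^\top\bar z'_{k+1}+Q_k\bar x_k,\\ \bar x_0&=-M^{-1}\bar y_0,\\ 0&=e^{-\rho}B_k^\top\bar y'_{k+1}+e^{-\rho}D_k^\top\bar z'_{k+1}+R_k\bar u_k.\end{aligned}$$ **Theorem.** Assume that $M$ is positive definite, that almost surely $Q_k\ge0$ for all $k$, that there is a constant $\delta>0$ such that almost surely $R_k-\delta I_m\ge0$ for all $k$, and that $$\rho>\ln\Big(6\big(\|A\|_\infty+\|C\|_\infty\big)^2\Big)\qquad(\ln 0:=-\infty).$$ Then for every admissible pair the state process belongs to $L^{2,\rho}_{\mathbb F}(\mathbb R^n)$, the series in $J$ converges almost surely, and the random variable inside the expectation is integrable. The Hamiltonian system has a solution $(\bar x,\bar y)\in L^{2,\rho}_{\mathbb F}(\mathbb R^n)\times L^{2,\rho}_{\mathbb F}(\mathbb R^n)$ with a control $\bar u\in\mathbb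 U$, and $(\bar x,\bar y,\bar u)$ is unique up to almost sure equality. Moreover $\bar u_k=-R_k^{-1}\big(e^{-\rho}B_k^\top\bar y'_{k+1}+e^{-\rho}D_k^\top\bar z'_{k+1}\big)$ almost surely for every $k$, and the pair $$\bar\xi=-M^{-1}\bar y_0,\qquad \bar u_k=-R_k^{-1}\big(e^{-\rho}B_k^\top\bar y'_{k+1}+e^{-\rho}D_k^\top\bar z'_{k+1}\big)$$ is optimal, and every optimal pair equals it almost surely. -/

import Mathlib

open MeasureTheory ProbabilityTheory
open scoped ENNReal InnerProductSpace

noncomputable section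

namespace ForwardLQ

/-- `past w k` is the sigma-algebra `F_{k-1}` generated by `w_0, ..., w_{k-1}`.
In particular `past w 0`, that is `F_{-1}`, is the trivial sigma-algebra. -/
@[reducible] def past {Ω : Type*} (w : ℕ → Ω → ℝ) (k : ℕ) : MeasurableSpace Ω :=
  ⨆ (l : ℕ) (_ : l < k), MeasurableSpace.comap (w l) inferInstance

/-- The driving noise: a real martingale difference sequence with conditional variance one,
`E[w_k | F_{k-1}] = 0` and `E[w_k ^ 2 | F_{k-1}] = 1` for all `k ≥ 0`. -/
structure IsNoise {Ω : Type*} [MeasurableSpace Ω] (μ : Measure Ω) (w : ℕ → Ω → ℝ) : Prop where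
  measurable : ∀ k, Measurable (w k)
  memLp : ∀ k, MemLp (w k) 2 μ
  condExp_eq_zero : ∀ k, μ[w k | past w k] =ᵐ[μ] fun _ => 0
  condExp_sq_eq_one : ∀ k, μ[fun ω => w k ω ^ 2 | past w k] =ᵐ[μ] fun _ => 1

/-- Square integrable `F_{-1}`-measurable random vectors. -/
def IsInitialState {Ω : Type*} [MeasurableSpace Ω] (μ : Measure Ω) (w : ℕ → Ω → ℝ) {d : ℕ}
    (ξ : Ω → EuclideanSpace ℝ (Fin d)) : Prop :=
  Measurable[past w 0] ξ ∧ MemLp ξ 2 μ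

/-- The space `L^{2,ρ}_F`: processes `g` with `g_k` measurable for `F_{k-1}` and
`E ∑_k e^{-ρ k} |g_k|^2 < ∞`. -/
def IsWeightedL2 {Ω : Type*} [MeasurableSpace Ω] (μ : Measure Ω) (w : ℕ → Ω → ℝ) (ρ : ℝ)
    {d : ℕ} (g : ℕ → Ω → EuclideanSpace ℝ (Fin d)) : Prop :=
  (∀ k, Measurable[past w k] (g k)) ∧
    ∫⁻ ω, ∑' k : ℕ, ENNReal.ofReal (Real.exp (-ρ * k)) * ‖g k ω‖ₑ ^ 2 ∂μ < ∞

/-- The norm `|A| = √(tr(A Aᵀ))` of a real matrix. -/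
def matNorm {p q : ℕ} (A : Matrix (Fin p) (Fin q) ℝ) : ℝ :=
  Real.sqrt (A * A.transpose).trace

/-- The norm of `L^∞_F`: supremum over `k` of the essential supremum of `|A_k|`. -/
def supNorm {Ω : Type*} [MeasurableSpace Ω] (μ : Measure Ω) {p q : ℕ}
    (A : ℕ → Ω → Matrix (Fin p) (Fin q) ℝ) : ℝ≥0∞ :=
  ⨆ k, essSup (fun ω => ENNReal.ofReal (matNorm (A k ω))) μ

/-- The space `L^∞_F`: essentially bounded matrix processes with `A_k` measurable for `F_{k-1}`. -/
def IsBoundedProcess {Ω : Type*} [MeasurableSpace Ω] (μ : Measure Ω) (w : ℕ → Ω → ℝ) {p q : ℕ}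
    (A : ℕ → Ω → Matrix (Fin p) (Fin q) ℝ) : Prop :=
  (∀ k i j, Measurable[past w k] fun ω => A k ω i j) ∧ supNorm μ A < ∞

/-- The matrix `A` applied to the vector `x`. -/
def act {p q : ℕ} (A : Matrix (Fin p) (Fin q) ℝ) (x : EuclideanSpace ℝ (Fin q)) :
    EuclideanSpace ℝ (Fin p) :=
  Matrix.toEuclideanLin A x

/-- Coefficients of a forward linear-quadratic problem with state in `ℝⁿ` and control in `ℝᵐ`. -/
structure Coeffs (Ω : Type*) (n m : ℕ) where
  /-- the discount exponent -/
  ρ : ℝ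
  A : ℕ → Ω → Matrix (Fin n) (Fin n) ℝ
  B : ℕ → Ω → Matrix (Fin n) (Fin m) ℝ
  C : ℕ → Ω → Matrix (Fin n) (Fin n) ℝ
  D : ℕ → Ω → Matrix (Fin n) (Fin m) ℝ
  b : ℕ → Ω → EuclideanSpace ℝ (Fin n)
  σ : ℕ → Ω → EuclideanSpace ℝ (Fin n)
  M : Matrix (Fin n) (Fin n) ℝ
  Q : ℕ → Ω → Matrix (Fin n) (Fin n) ℝ
  R : ℕ → Ω → Matrix (Fin m) (Fin m) ℝ

/-- The function spaces to which the coefficients belong. -/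
structure Coeffs.IsRegular {Ω : Type*} [MeasurableSpace Ω] {n m : ℕ} (P : Coeffs Ω n m)
    (μ : Measure Ω) (w : ℕ → Ω → ℝ) : Prop where
  A_mem : IsBoundedProcess μ w P.A
  B_mem : IsBoundedProcess μ w P.B
  C_mem : IsBoundedProcess μ w P.C
  D_mem : IsBoundedProcess μ w P.D
  b_mem : IsWeightedL2 μ w P.ρ P.b
  σ_mem : IsWeightedL2 μ w P.ρ P.σ
  Q_mem : IsBoundedProcess μ w P.Q
  R_mem : IsBoundedProcess μ w P.R

/-- One step of the state equation:
`A_k x + B_k u + b_k + (C_k x + D_k u + σ_k) w_k`. -/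
def Coeffs.step {Ω : Type*} {n m : ℕ} (P : Coeffs Ω n m) (w : ℕ → Ω → ℝ) (k : ℕ) (ω : Ω)
    (x : EuclideanSpace ℝ (Fin n)) (u : EuclideanSpace ℝ (Fin m)) : EuclideanSpace ℝ (Fin n) :=
  act (P.A k ω) x + act (P.B k ω) u + P.b k ω +
    w k ω • (act (P.C k ω) x + act (P.D k ω) u + P.σ k ω)

/-- The state process with initial state `ξ` and control `u`. -/
def Coeffs.state {Ω : Type*} {n m : ℕ} (P : Coeffs Ω n m) (w : ℕ → Ω → ℝ)
    (ξ : Ω → EuclideanSpace ℝ (Fin n)) (u : ℕ → Ω → EuclideanSpace ℝ (Fin m)) :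
    ℕ → Ω → EuclideanSpace ℝ (Fin n)
  | 0 => ξ
  | k + 1 => fun ω => P.step w k ω (P.state w ξ u k ω) (u k ω)

/-- The discounted running cost at time `k`. -/
def Coeffs.runningCost {Ω : Type*} {n m : ℕ} (P : Coeffs Ω n m) (w : ℕ → Ω → ℝ)
    (ξ : Ω → EuclideanSpace ℝ (Fin n)) (u : ℕ → Ω → EuclideanSpace ℝ (Fin m))
    (k : ℕ) (ω : Ω) : ℝ :=
  Real.exp (-P.ρ * k) *
    (⟪act (P.Q k ω) (P.state w ξ u k ω), P.state w ξ u k ω⟫_ℝ + ⟪act (P.R k ω) (u k ω), u k ω⟫_ℝ)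

/-- The pathwise total cost, before expectation and the factor `1 / 2`. -/
def Coeffs.pathCost {Ω : Type*} {n m : ℕ} (P : Coeffs Ω n m) (w : ℕ → Ω → ℝ)
    (ξ : Ω → EuclideanSpace ℝ (Fin n)) (u : ℕ → Ω → EuclideanSpace ℝ (Fin m)) (ω : Ω) : ℝ :=
  ⟪act P.M (ξ ω), ξ ω⟫_ℝ + ∑' k : ℕ, P.runningCost w ξ u k ω

/-- The cost functional `J(0; ξ, u)`. -/
def Coeffs.cost {Ω : Type*} [MeasurableSpace Ω] {n m : ℕ} (P : Coeffs Ω n m) (μ : Measure Ω)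
    (w : ℕ → Ω → ℝ) (ξ : Ω → EuclideanSpace ℝ (Fin n))
    (u : ℕ → Ω → EuclideanSpace ℝ (Fin m)) : ℝ :=
  (1 / 2) * ∫ ω, P.pathCost w ξ u ω ∂μ

/-- Admissible pairs of an initial state and a control. -/
def Coeffs.IsAdmissible {Ω : Type*} [MeasurableSpace Ω] {n m : ℕ} (P : Coeffs Ω n m)
    (μ : Measure Ω) (w : ℕ → Ω → ℝ) (ξ : Ω → EuclideanSpace ℝ (Fin n))
    (u : ℕ → Ω → EuclideanSpace ℝ (Fin m)) : Prop :=
  IsInitialState μ w ξ ∧ IsWeightedL2 μ w P.ρ u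

/-- The pair `(ξ, u)` is admissible and attains the infimum of the cost over admissible pairs. -/
def Coeffs.IsOptimal {Ω : Type*} [MeasurableSpace Ω] {n m : ℕ} (P : Coeffs Ω n m)
    (μ : Measure Ω) (w : ℕ → Ω → ℝ) (ξ : Ω → EuclideanSpace ℝ (Fin n))
    (u : ℕ → Ω → EuclideanSpace ℝ (Fin m)) : Prop :=
  P.IsAdmissible μ w ξ u ∧ ∀ ζ v, P.IsAdmissible μ w ζ v → P.cost μ w ξ u ≤ P.cost μ w ζ v

/-- `y'_{k+1} = E[y_{k+1} | F_{k-1}]`. -/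
def yPrime {Ω : Type*} [MeasurableSpace Ω] (μ : Measure Ω) (w : ℕ → Ω → ℝ) {n : ℕ}
    (y : ℕ → Ω → EuclideanSpace ℝ (Fin n)) (k : ℕ) : Ω → EuclideanSpace ℝ (Fin n) :=
  μ[y (k + 1) | past w k]

/-- `z'_{k+1} = E[y_{k+1} w_k | F_{k-1}]`. -/
def zPrime {Ω : Type*} [MeasurableSpace Ω] (μ : Measure Ω) (w : ℕ → Ω → ℝ) {n : ℕ}
    (y : ℕ → Ω → EuclideanSpace ℝ (Fin n)) (k : ℕ) : Ω → EuclideanSpace ℝ (Fin n) :=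
  μ[fun ω => w k ω • y (k + 1) ω | past w k]

/-- Solutions `(x, y)`, with control `u`, of the stochastic Hamiltonian system; all equations
hold almost surely. -/
structure Coeffs.IsHamiltonianSolution {Ω : Type*} [MeasurableSpace Ω] {n m : ℕ}
    (P : Coeffs Ω n m) (μ : Measure Ω) (w : ℕ → Ω → ℝ)
    (x y : ℕ → Ω → EuclideanSpace ℝ (Fin n)) (u : ℕ → Ω → EuclideanSpace ℝ (Fin m)) : Prop where
  x_mem : IsWeightedL2 μ w P.ρ x
  y_mem : IsWeightedL2 μ w P.ρ y
  u_mem : IsWeightedL2 μ w P.ρ u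
  forward : ∀ k, ∀ᵐ ω ∂μ, x (k + 1) ω = P.step w k ω (x k ω) (u k ω)
  backward : ∀ k, ∀ᵐ ω ∂μ, y k ω =
    Real.exp (-P.ρ) • act (P.A k ω).transpose (yPrime μ w y k ω) +
      Real.exp (-P.ρ) • act (P.C k ω).transpose (zPrime μ w y k ω) + act (P.Q k ω) (x k ω)
  initial : ∀ᵐ ω ∂μ, x 0 ω = -act P.M⁻¹ (y 0 ω)
  stationary : ∀ k, ∀ᵐ ω ∂μ, 0 =
    Real.exp (-P.ρ) • act (P.B k ω).transpose (yPrime μ w y k ω) +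
      Real.exp (-P.ρ) • act (P.D k ω).transpose (zPrime μ w y k ω) + act (P.R k ω) (u k ω)

/-- The initial state `-M⁻¹ y_0`. -/
def Coeffs.candidateState {Ω : Type*} {n m : ℕ} (P : Coeffs Ω n m)
    (y : ℕ → Ω → EuclideanSpace ℝ (Fin n)) (ω : Ω) : EuclideanSpace ℝ (Fin n) :=
  -act P.M⁻¹ (y 0 ω)

/-- The control `-R_k⁻¹ (e^{-ρ} B_kᵀ y'_{k+1} + e^{-ρ} D_kᵀ z'_{k+1})`. -/
def Coeffs.candidateControl {Ω : Type*} [MeasurableSpace Ω] {n m : ℕ} (P : Coeffs Ω n m)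
    (μ : Measure Ω) (w : ℕ → Ω → ℝ) (y : ℕ → Ω → EuclideanSpace ℝ (Fin n)) (k : ℕ) (ω : Ω) :
    EuclideanSpace ℝ (Fin m) :=
  -act (P.R k ω)⁻¹ (Real.exp (-P.ρ) • act (P.B k ω).transpose (yPrime μ w y k ω) +
    Real.exp (-P.ρ) • act (P.D k ω).transpose (zPrime μ w y k ω))

end ForwardLQ

end

/-!
The spaces `L^{2,ρ}_F(ℝ^d)` are Hilbert spaces: `ProcessSpace μ w ρ d` is the `L²` space of the
measure `∑_k e^{-ρ k} δ_k ⊗ μ` on `ℕ × Ω` with the predictable sigma-algebra. Let `N_v` be the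
weighted shift `(g_k)_k ↦ (0, v_0 g_0, v_1 g_1, …)` (`shiftOp`), for `v = 1` and for `v = w`. Since
`E[w_k² | F_{k-1}] = 1`, both shifts have norm at most `e^{-ρ/2}`. In terms of the multiplication
operators the state equation reads `x = S x + L (ξ, u) + f` with `S = N_1 A + N_w C` and
`L (ξ, u) = (ξ, 0, 0, …) + (N_1 B + N_w D) u`, and `‖S‖ ≤ e^{-ρ/2} (‖A‖_∞ + ‖C‖_∞) < 1` by the
assumption on `ρ`. As `F_{-1}` is trivial, an initial state is a vector in `ℝⁿ`.

The adjoint of `N_v` is `y ↦ e^{-ρ} E[v_k y_{k+1} | F_{k-1}]` (`adjoint_shiftOp_at`), so that `y'` and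
`z'` are the adjoints of the two shifts, and the Hamiltonian system is
`x = S x + L v + f`, `y = S† y + Q x`, `(M ⊕ R) v + L† y = 0` (`isHamiltonianSolution_iff`). This is
the first order condition for minimizing `⟪(M ⊕ R) v, v⟫ + ⟪Q x, x⟫`, which is twice the cost
(`cost_eq`). The rest is Hilbert space theory (`HilbertLQ`): elimination of `x` and `y` leaves a
linear equation for `v` with a coercive operator, which gives existence; pairing differences of
solutions gives uniqueness; and because the first variation vanishes, the cost of any other
control exceeds that of the solution by at least a multiple of the squared distance.
-/

noncomputable section

namespace ForwardLQ

/-! ### Quadratic control problems in Hilbert spaces -/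

section Hilbert

open ContinuousLinearMap

variable {H V : Type*} [NormedAddCommGroup H] [InnerProductSpace ℝ H] [CompleteSpace H]
  [NormedAddCommGroup V] [InnerProductSpace ℝ V] [CompleteSpace V]

/-- A linear-quadratic control problem in Hilbert spaces: the state `x ∈ H` belonging to the
control `v ∈ V` solves `x = S x + L v + f`, where `S` is a strict contraction, and the cost is
`⟪N v, v⟫ + ⟪Q x, x⟫` with `N` coercive and `Q` nonnegative. -/
structure HilbertLQ (H V : Type*) [NormedAddCommGroup H] [InnerProductSpace ℝ H]
    [NormedAddCommGroup V] [InnerProductSpace ℝ V] where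
  S : H →L[ℝ] H
  L : V →L[ℝ] H
  Q : H →L[ℝ] H
  N : V →L[ℝ] V
  f : H
  norm_S_lt : ‖S‖ < 1
  Q_symm : ∀ x y, ⟪Q x, y⟫_ℝ = ⟪x, Q y⟫_ℝ
  Q_nonneg : ∀ x, 0 ≤ ⟪Q x, x⟫_ℝ
  N_symm : ∀ x y, ⟪N x, y⟫_ℝ = ⟪x, N y⟫_ℝ
  /-- the coercivity constant of `N` -/
  c : ℝ
  c_pos : 0 < c
  N_coercive : ∀ v, c * ‖v‖ ^ 2 ≤ ⟪N v, v⟫_ℝ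

/-- The optimality system of a Hilbert space control problem: state equation, adjoint equation,
stationarity. -/
structure HilbertLQ.IsSolution (D : HilbertLQ H V) (x y : H) (v : V) : Prop where
  state : x = D.S x + D.L v + D.f
  adj : y = adjoint D.S y + D.Q x
  stat : D.N v + adjoint D.L y = 0

theorem eq_zero_of_eq_contraction {H : Type*} [NormedAddCommGroup H] [NormedSpace ℝ H]
    {S : H →L[ℝ] H} (hS : ‖S‖ < 1) {x : H} (hx : x = S x) :
    x = 0 := by
  by_contra h
  have h1 := S.le_opNorm x
  rw [← hx] at h1
  have : 0 < ‖x‖ := norm_pos_iff.2 h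
  nlinarith

theorem exists_eq_contraction_add {S : H →L[ℝ] H} (hS : ‖S‖ < 1) (g : H) :
    ∃ x, x = S x + g := by
  obtain ⟨T, hT⟩ := isUnit_one_sub_of_norm_lt_one hS
  refine ⟨(↑T⁻¹ : H →L[ℝ] H) g, ?_⟩
  have h : ((1 - S) * (↑T⁻¹ : H →L[ℝ] H)) g = g := by
    rw [← hT, Units.mul_inv]; rfl
  have h2 : (↑T⁻¹ : H →L[ℝ] H) g - S ((↑T⁻¹ : H →L[ℝ] H) g) = g := h
  rw [← sub_eq_iff_eq_add'] ; exact h2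

/-- The optimality system is solvable: eliminating state and adjoint state leaves the equation
`(N + G† Q G) v = - G† Q x₀` with `G = (1 - S)⁻¹ L`, whose operator is coercive. -/
theorem HilbertLQ.exists_isSolution (D : HilbertLQ H V) : ∃ x y v, D.IsSolution x y v := by
  obtain ⟨T, hT⟩ := isUnit_one_sub_of_norm_lt_one D.norm_S_lt
  set T' : H →L[ℝ] H := ↑T⁻¹ with hT'
  have hTT : ∀ g, T' g - D.S (T' g) = g := fun g => by
    have : ((1 - D.S) * T') g = g := by rw [← hT, hT', Units.mul_inv]; rfl
    exact this
  have hTT2 : ∀ g, T' (g - D.S g) = g := fun g => by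
    have : (T' * (1 - D.S)) g = g := by rw [← hT, hT', Units.inv_mul]; rfl
    exact this
  -- the linear part of the map from controls to states
  set G : V →L[ℝ] H := T' ∘L D.L with hG
  have hunit : IsUnit (D.N + adjoint G ∘L D.Q ∘L G) := by
    refine isUnit_of_forall_le_norm_inner_map _ (c := ⟨D.c, D.c_pos.le⟩) D.c_pos fun v => ?_
    have h1 := D.N_coercive v
    have h2 := D.Q_nonneg (G v)
    have h3 : ⟪(D.N + adjoint G ∘L D.Q ∘L G) v, v⟫_ℝ = ⟪D.N v, v⟫_ℝ + ⟪D.Q (G v), G v⟫_ℝ := by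
      simp [inner_add_left, adjoint_inner_left]
    rw [h3, Real.norm_eq_abs]
    refine le_trans ?_ (le_abs_self _)
    change ‖v‖ ^ 2 * D.c ≤ _
    linarith
  obtain ⟨K, hK⟩ := hunit
  set v : V := (↑K⁻¹ : V →L[ℝ] V) (-(adjoint G (D.Q (T' D.f)))) with hv
  have hKv : D.N v + adjoint G (D.Q (G v)) = -(adjoint G (D.Q (T' D.f))) := by
    have : ((D.N + adjoint G ∘L D.Q ∘L G) * (↑K⁻¹ : V →L[ℝ] V))
        (-(adjoint G (D.Q (T' D.f)))) = -(adjoint G (D.Q (T' D.f))) := by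
      rw [← hK, Units.mul_inv]; rfl
    exact this
  set x := T' (D.L v + D.f) with hx
  set y := adjoint T' (D.Q x) with hy
  refine ⟨x, y, v, ?_, ?_, ?_⟩
  · have := hTT (D.L v + D.f)
    rw [← hx, sub_eq_iff_eq_add] at this
    rw [add_assoc, add_comm (D.S x)]; exact this
  · refine ext_inner_right ℝ fun g => ?_
    rw [inner_add_left, adjoint_inner_left, hy, adjoint_inner_left, adjoint_inner_left,
      ← sub_eq_iff_eq_add', ← inner_sub_right, ← map_sub, hTT2]
  · have h1 : adjoint D.L y = adjoint G (D.Q x) := by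
      rw [hG, adjoint_comp, hy]; rfl
    have h2 : x = G v + T' D.f := by rw [hx, map_add, hG]; rfl
    rw [h1, h2, map_add, map_add, ← add_assoc, hKv, neg_add_cancel]

/-- Pairing the difference of two states with that of two adjoint states gives
`⟪N dv, dv⟫ + ⟪Q dx, dx⟫ = 0`. -/
theorem HilbertLQ.IsSolution.unique {D : HilbertLQ H V} {x y x' y' : H} {v v' : V}
    (h : D.IsSolution x y v) (h' : D.IsSolution x' y' v') : x = x' ∧ y = y' ∧ v = v' := by
  have e1 : x - x' = D.S (x - x') + D.L (v - v') := by
    rw [map_sub, map_sub]; nth_rewrite 1 [h.state, h'.state]; abel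
  have e2 : y - y' = adjoint D.S (y - y') + D.Q (x - x') := by
    rw [map_sub, map_sub]; nth_rewrite 1 [h.adj, h'.adj]; abel
  have e3 : D.N (v - v') + adjoint D.L (y - y') = 0 := by
    rw [map_sub, map_sub]
    have := congrArg₂ (· - ·) h.stat h'.stat
    simp only [sub_zero] at this
    rw [← this]; abel
  have a1 : ⟪y - y', x - x'⟫_ℝ = ⟪y - y', D.S (x - x')⟫_ℝ + ⟪y - y', D.L (v - v')⟫_ℝ := by
    rw [← inner_add_right, ← e1]
  have a2 : ⟪y - y', x - x'⟫_ℝ = ⟪y - y', D.S (x - x')⟫_ℝ + ⟪D.Q (x - x'), x - x'⟫_ℝ := by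
    rw [← adjoint_inner_left, ← inner_add_left, ← e2]
  have a3 : ⟪D.N (v - v'), v - v'⟫_ℝ + ⟪y - y', D.L (v - v')⟫_ℝ = 0 := by
    rw [← adjoint_inner_left, ← inner_add_left, e3, inner_zero_left]
  have a4 := D.N_coercive (v - v')
  have a5 := D.Q_nonneg (x - x')
  have hv : v - v' = 0 := by
    have := D.c_pos
    have : ‖v - v'‖ ^ 2 ≤ 0 := by
      by_contra hh
      push Not at hh
      nlinarith
    exact norm_eq_zero.1 (pow_eq_zero_iff two_ne_zero |>.1 (le_antisymm this (sq_nonneg _)))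
  rw [hv, map_zero, add_zero] at e1
  have hx := eq_zero_of_eq_contraction D.norm_S_lt e1
  rw [hx, map_zero, add_zero] at e2
  have hy := eq_zero_of_eq_contraction (by rw [LinearIsometryEquiv.norm_map]; exact D.norm_S_lt) e2
  exact ⟨sub_eq_zero.1 hx, sub_eq_zero.1 hy, sub_eq_zero.1 hv⟩

/-- The cost of an arbitrary control exceeds the cost of a stationary one by the cost of the
difference, because the first variation vanishes. -/
theorem HilbertLQ.IsSolution.cost_add_le {D : HilbertLQ H V} {x y x' : H} {v v' : V}
    (h : D.IsSolution x y v) (h' : x' = D.S x' + D.L v' + D.f) :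
    ⟪D.N v, v⟫_ℝ + ⟪D.Q x, x⟫_ℝ + D.c * ‖v' - v‖ ^ 2 ≤ ⟪D.N v', v'⟫_ℝ + ⟪D.Q x', x'⟫_ℝ := by
  obtain ⟨p, rfl⟩ : ∃ p, v' = v + p := ⟨v' - v, by abel⟩
  obtain ⟨q, rfl⟩ : ∃ q, x' = x + q := ⟨x' - x, by abel⟩
  have e1 : q = D.S q + D.L p := by
    have hs := h.state
    simp only [map_add] at h'
    have h2 : (x + q) - x = _ := congrArg₂ (· - ·) h' hs
    rw [add_sub_cancel_left] at h2
    exact h2.trans (by abel)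
  have a1 : ⟪y, q⟫_ℝ = ⟪y, D.S q⟫_ℝ + ⟪y, D.L p⟫_ℝ := by rw [← inner_add_right, ← e1]
  have a2 : ⟪y, q⟫_ℝ = ⟪y, D.S q⟫_ℝ + ⟪D.Q x, q⟫_ℝ := by
    rw [← adjoint_inner_left, ← inner_add_left, ← h.adj]
  have a3 : ⟪D.N v, p⟫_ℝ + ⟪y, D.L p⟫_ℝ = 0 := by
    rw [← adjoint_inner_left, ← inner_add_left, h.stat, inner_zero_left]
  have a4 := D.N_coercive p
  have a5 := D.Q_nonneg q
  have a6 : ⟪D.N p, v⟫_ℝ = ⟪D.N v, p⟫_ℝ := by rw [D.N_symm, real_inner_comm]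
  have a7 : ⟪D.Q q, x⟫_ℝ = ⟪D.Q x, q⟫_ℝ := by rw [D.Q_symm, real_inner_comm]
  simp only [map_add, inner_add_left, inner_add_right, add_sub_cancel_left]
  linarith

end Hilbert

/-! ### Matrices acting on Euclidean spaces -/

section Matrices

variable {p q : ℕ}

theorem act_add (A : Matrix (Fin p) (Fin q) ℝ) (x y : EuclideanSpace ℝ (Fin q)) :
    act A (x + y) = act A x + act A y := map_add _ _ _

theorem act_smul (A : Matrix (Fin p) (Fin q) ℝ) (c : ℝ) (x : EuclideanSpace ℝ (Fin q)) :
    act A (c • x) = c • act A x := map_smul _ _ _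

theorem act_neg (A : Matrix (Fin p) (Fin q) ℝ) (x : EuclideanSpace ℝ (Fin q)) :
    act A (-x) = -act A x := map_neg _ _

theorem act_apply (A : Matrix (Fin p) (Fin q) ℝ) (x : EuclideanSpace ℝ (Fin q)) (i : Fin p) :
    act A x i = ∑ j, A i j * x j := by
  simp [act, Matrix.mulVec, dotProduct]

theorem act_act {r : ℕ} (A : Matrix (Fin p) (Fin q) ℝ) (B : Matrix (Fin q) (Fin r) ℝ)
    (x : EuclideanSpace ℝ (Fin r)) : act A (act B x) = act (A * B) x := by
  simp [act, Matrix.toLpLin_apply, Matrix.mulVec_mulVec]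

theorem act_one (x : EuclideanSpace ℝ (Fin p)) : act (1 : Matrix (Fin p) (Fin p) ℝ) x = x := by
  simp [act]

theorem inner_act_left (A : Matrix (Fin p) (Fin q) ℝ) (x : EuclideanSpace ℝ (Fin q))
    (y : EuclideanSpace ℝ (Fin p)) : ⟪act A x, y⟫_ℝ = ⟪x, act A.transpose y⟫_ℝ := by
  simp only [PiLp.inner_apply, act_apply, RCLike.inner_apply, conj_trivial, Finset.mul_sum,
    Finset.sum_mul, Matrix.transpose_apply]
  rw [Finset.sum_comm]
  exact Finset.sum_congr rfl fun i _ => Finset.sum_congr rfl fun j _ => by ring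

theorem inner_act_self (A : Matrix (Fin p) (Fin p) ℝ) (x : EuclideanSpace ℝ (Fin p)) :
    ⟪act A x, x⟫_ℝ = star x.ofLp ⬝ᵥ A.mulVec x.ofLp := by
  simp only [PiLp.inner_apply, act_apply, RCLike.inner_apply, conj_trivial, dotProduct,
    Matrix.mulVec, star_trivial]

theorem inner_act_nonneg {A : Matrix (Fin p) (Fin p) ℝ} (hA : A.PosSemidef)
    (x : EuclideanSpace ℝ (Fin p)) : 0 ≤ ⟪act A x, x⟫_ℝ := by
  rw [inner_act_self]; exact hA.dotProduct_mulVec_nonneg _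

theorem transpose_eq_of_posSemidef {A : Matrix (Fin p) (Fin p) ℝ} (hA : A.PosSemidef) :
    A.transpose = A := by
  have := hA.isHermitian.eq
  rwa [Matrix.conjTranspose_eq_transpose_of_trivial] at this

theorem trace_mul_transpose_eq_sum (A : Matrix (Fin p) (Fin q) ℝ) :
    (A * A.transpose).trace = ∑ i, ∑ j, A i j ^ 2 := by
  simp [Matrix.trace, Matrix.mul_apply, sq]

theorem norm_act_le (A : Matrix (Fin p) (Fin q) ℝ) (x : EuclideanSpace ℝ (Fin q)) :
    ‖act A x‖ ≤ matNorm A * ‖x‖ := by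
  rw [EuclideanSpace.norm_eq, EuclideanSpace.norm_eq, matNorm, trace_mul_transpose_eq_sum,
    ← Real.sqrt_mul (by positivity)]
  refine Real.sqrt_le_sqrt ?_
  rw [Finset.sum_mul]
  refine Finset.sum_le_sum fun i _ => ?_
  simp only [Real.norm_eq_abs, sq_abs, act_apply]
  exact Finset.sum_mul_sq_le_sq_mul_sq _ _ _

theorem matNorm_transpose (A : Matrix (Fin p) (Fin q) ℝ) : matNorm A.transpose = matNorm A := by
  rw [matNorm, matNorm, trace_mul_transpose_eq_sum, trace_mul_transpose_eq_sum, Finset.sum_comm]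
  rfl

/-- A positive definite matrix on a finite-dimensional space is coercive. -/
theorem exists_coercive_of_posDef {A : Matrix (Fin p) (Fin p) ℝ} (hA : A.PosDef) :
    ∃ c > 0, ∀ x : EuclideanSpace ℝ (Fin p), c * ‖x‖ ^ 2 ≤ ⟪act A x, x⟫_ℝ := by
  have hpos : ∀ x : EuclideanSpace ℝ (Fin p), x ≠ 0 → 0 < ⟪act A x, x⟫_ℝ := fun x hx => by
    rw [inner_act_self]
    exact hA.dotProduct_mulVec_pos (by simpa using hx)
  have hcont : Continuous fun x : EuclideanSpace ℝ (Fin p) => ⟪act A x, x⟫_ℝ :=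
    (LinearMap.continuous_of_finiteDimensional (Matrix.toEuclideanLin A)).inner continuous_id
  rcases (Metric.sphere (0 : EuclideanSpace ℝ (Fin p)) 1).eq_empty_or_nonempty with h | h
  -- the unit sphere is empty only in dimension zero
  · refine ⟨1, one_pos, fun x => ?_⟩
    have hx : x = 0 := by
      by_contra hx
      have : ‖x‖⁻¹ • x ∈ Metric.sphere (0 : EuclideanSpace ℝ (Fin p)) 1 := by
        simp [norm_smul, hx]
      rw [h] at this; exact this
    simp [hx]
  · obtain ⟨z, hz, hmin⟩ := (isCompact_sphere _ _).exists_isMinOn h hcont.continuousOn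
    have hz0 : z ≠ 0 := fun h0 => by simp [h0] at hz
    refine ⟨_, hpos z hz0, fun x => ?_⟩
    by_cases hx : x = 0
    · simp [hx]
    have hmem : ‖x‖⁻¹ • x ∈ Metric.sphere (0 : EuclideanSpace ℝ (Fin p)) 1 := by
      simp [norm_smul, hx]
    have h1 := hmin hmem
    simp only [Set.mem_ofPred_eq, act_smul, real_inner_smul_left, real_inner_smul_right] at h1
    have hn : 0 < ‖x‖ := norm_pos_iff.2 hx
    calc ⟪act A z, z⟫_ℝ * ‖x‖ ^ 2
        ≤ (‖x‖⁻¹ * (‖x‖⁻¹ * ⟪act A x, x⟫_ℝ)) * ‖x‖ ^ 2 := by gcongr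
      _ = _ := by field_simp

/-- `R ≥ δ I` in terms of the quadratic form. -/
theorem inner_act_ge_of_sub_posSemidef {A : Matrix (Fin p) (Fin p) ℝ} {δ : ℝ}
    (hA : (A - δ • (1 : Matrix (Fin p) (Fin p) ℝ)).PosSemidef) (x : EuclideanSpace ℝ (Fin p)) :
    δ * ‖x‖ ^ 2 ≤ ⟪act A x, x⟫_ℝ := by
  have h := inner_act_nonneg hA x
  rw [inner_act_self] at h ⊢
  rw [Matrix.sub_mulVec, dotProduct_sub, Matrix.smul_mulVec, Matrix.one_mulVec,
    dotProduct_smul, sub_nonneg] at h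
  refine le_trans (le_of_eq ?_) h
  rw [EuclideanSpace.norm_sq_eq]
  simp [dotProduct, sq]

theorem posDef_of_sub_posSemidef {A : Matrix (Fin p) (Fin p) ℝ} {δ : ℝ} (hδ : 0 < δ)
    (hA : (A - δ • (1 : Matrix (Fin p) (Fin p) ℝ)).PosSemidef) : A.PosDef := by
  have h : (δ • (1 : Matrix (Fin p) (Fin p) ℝ)).PosDef := Matrix.PosDef.one.smul hδ
  simpa using Matrix.PosDef.posSemidef_add hA h

theorem inv_act_act {A : Matrix (Fin p) (Fin p) ℝ} (hA : A.PosDef)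
    (x : EuclideanSpace ℝ (Fin p)) : act A⁻¹ (act A x) = x := by
  rw [act_act, Matrix.nonsing_inv_mul _ ((Matrix.isUnit_iff_isUnit_det _).1 hA.isUnit), act_one]

theorem act_act_inv {A : Matrix (Fin p) (Fin p) ℝ} (hA : A.PosDef)
    (x : EuclideanSpace ℝ (Fin p)) : act A (act A⁻¹ x) = x := by
  rw [act_act, Matrix.mul_nonsing_inv _ ((Matrix.isUnit_iff_isUnit_det _).1 hA.isUnit), act_one]

theorem measurable_act {X : Type*} {mX : MeasurableSpace X} {A : X → Matrix (Fin p) (Fin q) ℝ}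
    {x : X → EuclideanSpace ℝ (Fin q)} (hA : ∀ i j, Measurable fun a => A a i j)
    (hx : Measurable x) : Measurable fun a => act (A a) (x a) := by
  have hx' : ∀ j, Measurable fun a => x a j := fun j =>
    (EuclideanSpace.proj (𝕜 := ℝ) j).continuous.measurable.comp hx
  have : Measurable fun a => (act (A a) (x a)).ofLp := by
    refine measurable_pi_lambda _ fun i => ?_
    simp only [act_apply]
    exact Finset.measurable_sum _ fun j _ => (hA i j).mul (hx' j)
  exact (PiLp.continuous_toLp 2 (fun _ : Fin p => ℝ)).measurable.comp this

theorem measurable_inv_apply {X : Type*} {mX : MeasurableSpace X}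
    {A : X → Matrix (Fin p) (Fin p) ℝ} (hA : ∀ i j, Measurable fun a => A a i j) (i j : Fin p) :
    Measurable fun a => (A a)⁻¹ i j := by
  have hdet : ∀ B : X → Matrix (Fin p) (Fin p) ℝ, (∀ i j, Measurable fun a => B a i j) →
      Measurable fun a => (B a).det := fun B hB => by
    simp only [Matrix.det_apply']
    exact Finset.measurable_sum _ fun s _ =>
      measurable_const.mul (Finset.measurable_prod _ fun k _ => hB _ _)
  simp only [Matrix.inv_def, Matrix.smul_apply, Ring.inverse_eq_inv', smul_eq_mul,
    Matrix.adjugate_apply]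
  refine (hdet A hA).inv.mul (hdet _ fun k l => ?_)
  simp only [Matrix.updateRow_apply]
  split_ifs
  · exact measurable_const
  · exact hA k l

end Matrices

/-! ### Operators between `L²` spaces -/

section LpOperators

open scoped NNReal

variable {X Y E F : Type*} {mX : MeasurableSpace X} {mY : MeasurableSpace Y}
  [NormedAddCommGroup E] [NormedSpace ℝ E] [NormedAddCommGroup F] [NormedSpace ℝ F]
  {α : Measure X} {β : Measure Y}

theorem eLpNorm_two_sq {E : Type*} [NormedAddCommGroup E] (f : X → E) : eLpNorm f 2 α ^ 2 = ∫⁻ a, ‖f a‖ₑ ^ 2 ∂α := by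
  have := eLpNorm_nnreal_pow_eq_lintegral (μ := α) (f := f) (p := 2) two_ne_zero
  simpa using this

theorem memLp_two_iff {E : Type*} [NormedAddCommGroup E] {f : X → E} (hf : AEStronglyMeasurable f α) :
    MemLp f 2 α ↔ ∫⁻ a, ‖f a‖ₑ ^ 2 ∂α < ∞ := by
  rw [← eLpNorm_two_sq, ENNReal.pow_lt_top_iff]
  simp [MemLp, hf]

omit [NormedSpace ℝ E] [NormedSpace ℝ F] in
theorem eLpNorm_two_le {f : X → E} {g : Y → F} {c : ℝ≥0}
    (h : ∫⁻ a, ‖f a‖ₑ ^ 2 ∂α ≤ (c : ℝ≥0∞) ^ 2 * ∫⁻ b, ‖g b‖ₑ ^ 2 ∂β) :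
    eLpNorm f 2 α ≤ c * eLpNorm g 2 β := by
  rw [← eLpNorm_two_sq, ← eLpNorm_two_sq, ← mul_pow] at h
  exact (ENNReal.pow_le_pow_left_iff two_ne_zero).1 h

variable (Φ : (X → E) →ₗ[ℝ] (Y → F)) (hΦ : ∀ f, StronglyMeasurable f → StronglyMeasurable (Φ f))
  (c : ℝ≥0) (hc : ∀ f, StronglyMeasurable f →
    ∫⁻ b, ‖Φ f b‖ₑ ^ 2 ∂β ≤ (c : ℝ≥0∞) ^ 2 * ∫⁻ a, ‖f a‖ₑ ^ 2 ∂α)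

include hΦ hc in
/-- By the bound, `Φ` descends to classes of functions. -/
theorem ae_eq_map_of_ae_eq {f g : X → E} (hf : StronglyMeasurable f) (hg : StronglyMeasurable g)
    (h : f =ᵐ[α] g) : Φ f =ᵐ[β] Φ g := by
  have h1 := eLpNorm_two_le (hc _ (hf.sub hg))
  have h2 : eLpNorm (f - g) 2 α = 0 := by
    rw [eLpNorm_congr_ae (g := 0)]
    · simp
    · filter_upwards [h] with a ha; simp [ha]
  rw [h2, mul_zero, map_sub, nonpos_iff_eq_zero, eLpNorm_eq_zero_iff
    ((hΦ _ hf).sub (hΦ _ hg)).aestronglyMeasurable two_ne_zero] at h1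
  filter_upwards [h1] with b hb
  exact sub_eq_zero.1 hb

include hΦ hc in
theorem memLp_map {f : X → E} (hf : StronglyMeasurable f) (h : MemLp f 2 α) :
    MemLp (Φ f) 2 β :=
  ⟨(hΦ f hf).aestronglyMeasurable,
    (eLpNorm_two_le (hc f hf)).trans_lt (ENNReal.mul_lt_top ENNReal.coe_lt_top h.2)⟩

/-- The bounded operator between `L²` spaces induced by a linear map `Φ` of functions which
preserves measurability and is bounded for the `L²` seminorm. -/
def lpMap : Lp E 2 α →L[ℝ] Lp F 2 β :=
  LinearMap.mkContinuous
    { toFun := fun f => (memLp_map Φ hΦ c hc (Lp.stronglyMeasurable f) (Lp.memLp f)).toLp _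
      map_add' := fun f g => by
        rw [← MemLp.toLp_add, MemLp.toLp_eq_toLp_iff, ← map_add]
        exact ae_eq_map_of_ae_eq Φ hΦ c hc (Lp.stronglyMeasurable _)
          ((Lp.stronglyMeasurable f).add (Lp.stronglyMeasurable g)) (Lp.coeFn_add f g)
      map_smul' := fun r f => by
        rw [RingHom.id_apply, ← MemLp.toLp_const_smul, MemLp.toLp_eq_toLp_iff, ← map_smul]
        exact ae_eq_map_of_ae_eq Φ hΦ c hc (Lp.stronglyMeasurable _)
          ((Lp.stronglyMeasurable f).const_smul r) (Lp.coeFn_smul r f) } c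
    fun f => by
      change ‖(memLp_map Φ hΦ c hc (Lp.stronglyMeasurable f) (Lp.memLp f)).toLp _‖ ≤ _
      rw [Lp.norm_toLp, Lp.norm_def, ← ENNReal.coe_toReal, ← ENNReal.toReal_mul]
      exact ENNReal.toReal_mono (ENNReal.mul_ne_top ENNReal.coe_ne_top (Lp.memLp f).2.ne)
        (eLpNorm_two_le (hc _ (Lp.stronglyMeasurable f)))

theorem lpMap_coeFn (f : Lp E 2 α) : lpMap Φ hΦ c hc f =ᵐ[β] Φ f :=
  (memLp_map Φ hΦ c hc (Lp.stronglyMeasurable f) (Lp.memLp f)).coeFn_toLp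

theorem norm_lpMap_le : ‖lpMap Φ hΦ c hc‖ ≤ c :=
  LinearMap.mkContinuous_norm_le _ c.2 _

end LpOperators

/-! ### The predictable sigma-algebra and the discounted measure -/

section TimePath

variable {Ω : Type*}

/-- Pairs of a time and a sample point. The type depends on the noise `w`, because its
sigma-algebra, the predictable one, does. -/
def TimePath (_w : ℕ → Ω → ℝ) : Type _ := ℕ × Ω

/-- The point `(k, ω)`. -/
def TimePath.at (w : ℕ → Ω → ℝ) (k : ℕ) (ω : Ω) : TimePath w := ((k, ω) : ℕ × Ω)

/-- The predictable sigma-algebra: the section of a measurable set at time `k` belongs to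
`past w k`. -/
instance (w : ℕ → Ω → ℝ) : MeasurableSpace (TimePath w) :=
  ⨅ k, (past w k).map (TimePath.at w k)

/-- A process as a function of time and sample point. -/
def uncurried (w : ℕ → Ω → ℝ) {β : Type*} (g : ℕ → Ω → β) : TimePath w → β :=
  fun p => g (Prod.fst (show ℕ × Ω from p)) (Prod.snd (show ℕ × Ω from p))

variable {w : ℕ → Ω → ℝ}

@[simp] theorem uncurried_at {β : Type*} (g : ℕ → Ω → β) (k : ℕ) (ω : Ω) :
    uncurried w g (TimePath.at w k ω) = g k ω := rfl

theorem measurableSet_timePath {s : Set (TimePath w)} :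
    MeasurableSet s ↔ ∀ k, MeasurableSet[past w k] (TimePath.at w k ⁻¹' s) :=
  MeasurableSpace.measurableSet_iInf

theorem measurable_timePath {β : Type*} [MeasurableSpace β] {f : TimePath w → β} :
    Measurable f ↔ ∀ k, Measurable[past w k] fun ω => f (TimePath.at w k ω) :=
  ⟨fun h k _ hs => measurableSet_timePath.1 (h hs) k,
    fun h _ hs => measurableSet_timePath.2 fun k => h k hs⟩

theorem stronglyMeasurable_timePath {d : ℕ} {f : TimePath w → EuclideanSpace ℝ (Fin d)} :
    StronglyMeasurable f ↔ ∀ k, Measurable[past w k] fun ω => f (TimePath.at w k ω) :=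
  stronglyMeasurable_iff_measurable.trans measurable_timePath

variable [mΩ : MeasurableSpace Ω]

theorem past_le (hw : ∀ k, Measurable (w k)) (k : ℕ) : past w k ≤ mΩ :=
  iSup₂_le fun l _ => (hw l).comap_le

omit mΩ in
theorem past_mono {k l : ℕ} (h : k ≤ l) : past w k ≤ past w l :=
  iSup₂_le fun i hi => le_iSup₂_of_le i (hi.trans_le h) le_rfl

omit mΩ in
theorem measurable_noise_past (k : ℕ) : Measurable[past w (k + 1)] (w k) :=
  measurable_iff_comap_le.2 (le_iSup₂_of_le k k.lt_succ_self le_rfl)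

theorem measurable_at (hw : ∀ k, Measurable (w k)) (k : ℕ) : Measurable (TimePath.at w k) :=
  fun _ hs => past_le hw k _ (measurableSet_timePath.1 hs k)

/-- The measure `∑_k e^{-ρ k} δ_k ⊗ μ`, for which `L^{2,ρ}_F` is an `L²` space. -/
def discounted (μ : Measure Ω) (w : ℕ → Ω → ℝ) (ρ : ℝ) : Measure (TimePath w) :=
  Measure.sum fun k : ℕ => ENNReal.ofReal (Real.exp (-ρ * k)) • μ.map (TimePath.at w k)

variable {μ : Measure Ω} {ρ : ℝ} (hw : ∀ k, Measurable (w k))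

include hw

theorem lintegral_discounted {f : TimePath w → ℝ≥0∞} (hf : Measurable f) :
    ∫⁻ p, f p ∂discounted μ w ρ =
      ∑' k : ℕ, ENNReal.ofReal (Real.exp (-ρ * k)) * ∫⁻ ω, f (TimePath.at w k ω) ∂μ := by
  simp only [discounted, lintegral_sum_measure, lintegral_smul_measure, smul_eq_mul,
    lintegral_map hf (measurable_at hw _)]

theorem ae_at_of_ae {p : TimePath w → Prop} (h : ∀ᵐ a ∂discounted μ w ρ, p a) (k : ℕ) :
    ∀ᵐ ω ∂μ, p (TimePath.at w k ω) := by
  rw [discounted, Measure.ae_sum_iff] at h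
  have hk := h k
  rw [Measure.ae_ennreal_smul_measure_iff (by simp [Real.exp_pos])] at hk
  exact ae_of_ae_map (measurable_at hw k).aemeasurable hk

theorem ae_of_ae_at {p : TimePath w → Prop} (hp : MeasurableSet {a | p a})
    (h : ∀ k, ∀ᵐ ω ∂μ, p (TimePath.at w k ω)) : ∀ᵐ a ∂discounted μ w ρ, p a := by
  rw [discounted, Measure.ae_sum_iff]
  intro k
  rw [Measure.ae_ennreal_smul_measure_iff (by simp [Real.exp_pos])]
  exact (ae_map_iff (measurable_at hw k).aemeasurable hp).2 (h k)

theorem ae_eq_discounted_iff {d : ℕ} {f g : TimePath w → EuclideanSpace ℝ (Fin d)}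
    (hf : StronglyMeasurable f) (hg : StronglyMeasurable g) :
    f =ᵐ[discounted μ w ρ] g ↔
      ∀ k, (fun ω => f (TimePath.at w k ω)) =ᵐ[μ] fun ω => g (TimePath.at w k ω) :=
  ⟨fun h k => ae_at_of_ae hw h k,
    fun h => ae_of_ae_at hw (measurableSet_eq_fun hf.measurable hg.measurable) h⟩

/-- Integrals for the discounted measure, time by time. -/
theorem hasSum_integral_discounted {f : TimePath w → ℝ} (hf : Integrable f (discounted μ w ρ)) :
    HasSum (fun k : ℕ => Real.exp (-ρ * k) * ∫ ω, f (TimePath.at w k ω) ∂μ)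
      (∫ p, f p ∂discounted μ w ρ) := by
  have h := hasSum_integral_measure (show Integrable f (Measure.sum _) from hf)
  suffices e : (fun k : ℕ => Real.exp (-ρ * k) * ∫ ω, f (TimePath.at w k ω) ∂μ) = fun k : ℕ =>
      ∫ p, f p ∂(ENNReal.ofReal (Real.exp (-ρ * k)) • μ.map (TimePath.at w k)) by
    rw [e]; exact h
  funext k
  have hk : AEStronglyMeasurable f (μ.map (TimePath.at w k)) := by
    have h2 := hf.aestronglyMeasurable.mono_measure
      (Measure.le_sum (fun k : ℕ => ENNReal.ofReal (Real.exp (-ρ * k)) • μ.map (TimePath.at w k)) k)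
    exact h2.mono_ac (Measure.absolutelyContinuous_smul (by simp [Real.exp_pos]))
  rw [integral_smul_measure, integral_map (measurable_at hw k).aemeasurable hk,
    ENNReal.toReal_ofReal (Real.exp_pos _).le, smul_eq_mul]

/-- `L^{2,ρ}_F` is the space of predictable square integrable functions for the discounted
measure. -/
theorem isWeightedL2_iff {d : ℕ} {g : ℕ → Ω → EuclideanSpace ℝ (Fin d)} :
    IsWeightedL2 μ w ρ g ↔
      StronglyMeasurable (uncurried w g) ∧ MemLp (uncurried w g) 2 (discounted μ w ρ) := by
  have key : StronglyMeasurable (uncurried w g) →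
      ∫⁻ ω, ∑' k : ℕ, ENNReal.ofReal (Real.exp (-ρ * k)) * ‖g k ω‖ₑ ^ 2 ∂μ =
        ∫⁻ p, ‖uncurried w g p‖ₑ ^ 2 ∂discounted μ w ρ := fun h => by
    rw [lintegral_discounted hw (h.enorm.pow_const 2), lintegral_tsum]
    · refine tsum_congr fun k => ?_
      rw [lintegral_const_mul']
      · rfl
      · exact ENNReal.ofReal_ne_top
    · intro k
      have := (stronglyMeasurable_timePath.1 h k).mono (past_le hw k) le_rfl
      exact ((this.enorm.pow_const 2).const_mul _).aemeasurable
  constructor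
  · rintro ⟨h1, h2⟩
    have h : StronglyMeasurable (uncurried w g) := stronglyMeasurable_timePath.2 h1
    exact ⟨h, (memLp_two_iff h.aestronglyMeasurable).2 (key h ▸ h2)⟩
  · rintro ⟨h1, h2⟩
    exact ⟨stronglyMeasurable_timePath.1 h1,
      (key h1).symm ▸ (memLp_two_iff h1.aestronglyMeasurable).1 h2⟩

end TimePath

/-! ### The operators of the control problem -/

section Operators

open scoped NNReal

variable {Ω : Type*} [mΩ : MeasurableSpace Ω] (μ : Measure Ω) (w : ℕ → Ω → ℝ) (ρ : ℝ)

/-- The Hilbert space `L^{2,ρ}_F(ℝ^d)`. -/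
abbrev ProcessSpace (d : ℕ) : Type _ := Lp (EuclideanSpace ℝ (Fin d)) 2 (discounted μ w ρ)

variable {μ w ρ}

theorem measurable_coe_at {d : ℕ} (f : ProcessSpace μ w ρ d) (k : ℕ) :
    Measurable[past w k] fun ω => f (TimePath.at w k ω) :=
  stronglyMeasurable_timePath.1 (Lp.stronglyMeasurable f) k

theorem ext_processSpace (hw : ∀ k, Measurable (w k)) {d : ℕ} {f g : ProcessSpace μ w ρ d}
    (h : ∀ k, ∀ᵐ ω ∂μ, f (TimePath.at w k ω) = g (TimePath.at w k ω)) : f = g :=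
  Lp.ext ((ae_eq_discounted_iff hw (Lp.stronglyMeasurable f) (Lp.stronglyMeasurable g)).2 h)

/-- Each process in `L^{2,ρ}_F` comes from an element of the Hilbert space. -/
theorem IsWeightedL2.exists_processSpace (hw : ∀ k, Measurable (w k)) {d : ℕ}
    {g : ℕ → Ω → EuclideanSpace ℝ (Fin d)} (hg : IsWeightedL2 μ w ρ g) :
    ∃ f : ProcessSpace μ w ρ d, ∀ k, ∀ᵐ ω ∂μ, f (TimePath.at w k ω) = g k ω :=
  have h := (isWeightedL2_iff hw).1 hg
  ⟨h.2.toLp _, ae_at_of_ae hw h.2.coeFn_toLp⟩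

theorem memLp_at (hw : ∀ k, Measurable (w k)) {d : ℕ} (f : ProcessSpace μ w ρ d) (k : ℕ) :
    MemLp (fun ω => f (TimePath.at w k ω)) 2 μ := by
  have hm := ((measurable_coe_at f k).mono (past_le hw k) le_rfl).stronglyMeasurable
  rw [memLp_two_iff hm.aestronglyMeasurable]
  have h := (memLp_two_iff (Lp.stronglyMeasurable f).aestronglyMeasurable).1 (Lp.memLp f)
  rw [lintegral_discounted hw ((Lp.stronglyMeasurable f).enorm.pow_const 2)] at h
  have hk := (ENNReal.le_tsum k).trans_lt h
  exact ENNReal.lt_top_of_mul_ne_top_right hk.ne (by simp [Real.exp_pos])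

theorem hasSum_inner_processSpace (hw : ∀ k, Measurable (w k)) {d : ℕ}
    (f g : ProcessSpace μ w ρ d) :
    HasSum (fun k : ℕ => Real.exp (-ρ * k) *
      ∫ ω, ⟪f (TimePath.at w k ω), g (TimePath.at w k ω)⟫_ℝ ∂μ) ⟪f, g⟫_ℝ := by
  rw [L2.inner_def]
  exact hasSum_integral_discounted hw (L2.integrable_inner f g)

/-- Multiplication of functions by a matrix process. -/
def multLin (w : ℕ → Ω → ℝ) {p q : ℕ} (A : ℕ → Ω → Matrix (Fin p) (Fin q) ℝ) :
    (TimePath w → EuclideanSpace ℝ (Fin q)) →ₗ[ℝ] (TimePath w → EuclideanSpace ℝ (Fin p)) where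
  toFun f a := act (uncurried w A a) (f a)
  map_add' _ _ := funext fun _ => act_add _ _ _
  map_smul' _ _ := funext fun _ => act_smul _ _ _

section Mult

variable (hw : ∀ k, Measurable (w k)) {p q : ℕ} {A : ℕ → Ω → Matrix (Fin p) (Fin q) ℝ}
  (hA : ∀ k i j, Measurable[past w k] fun ω => A k ω i j) {a : ℝ≥0}
  (ha : ∀ k, ∀ᵐ ω ∂μ, matNorm (A k ω) ≤ a)

omit mΩ in
include hA in
theorem stronglyMeasurable_multLin (f : TimePath w → EuclideanSpace ℝ (Fin q))
    (hf : StronglyMeasurable f) : StronglyMeasurable (multLin w A f) :=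
  stronglyMeasurable_timePath.2 fun k => measurable_act (hA k) (stronglyMeasurable_timePath.1 hf k)

include hw hA ha in
theorem lintegral_multLin_le (f : TimePath w → EuclideanSpace ℝ (Fin q))
    (hf : StronglyMeasurable f) :
    ∫⁻ b, ‖multLin w A f b‖ₑ ^ 2 ∂discounted μ w ρ ≤
      (a : ℝ≥0∞) ^ 2 * ∫⁻ b, ‖f b‖ₑ ^ 2 ∂discounted μ w ρ := by
  rw [lintegral_discounted hw ((stronglyMeasurable_multLin hA f hf).enorm.pow_const 2),
    lintegral_discounted hw (hf.enorm.pow_const 2), ← ENNReal.tsum_mul_left]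
  refine ENNReal.tsum_le_tsum fun k => ?_
  rw [mul_left_comm, ← lintegral_const_mul' (a ^ 2 : ℝ≥0∞) _ (by simp)]
  refine mul_le_mul_right (lintegral_mono_ae ?_) _
  filter_upwards [ha k] with ω hω
  rw [← mul_pow]
  refine pow_le_pow_left₀ zero_le ?_ 2
  rw [← ofReal_norm, ← ofReal_norm, ← ENNReal.ofReal_coe_nnreal,
    ← ENNReal.ofReal_mul (by positivity)]
  exact ENNReal.ofReal_le_ofReal
    ((norm_act_le _ _).trans (mul_le_mul_of_nonneg_right hω (norm_nonneg _)))

/-- Multiplication by an essentially bounded, predictable matrix process. -/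
def multOp : ProcessSpace μ w ρ q →L[ℝ] ProcessSpace μ w ρ p :=
  lpMap (multLin w A) (stronglyMeasurable_multLin hA) a (lintegral_multLin_le hw hA ha)

theorem multOp_at (f : ProcessSpace μ w ρ q) (k : ℕ) :
    ∀ᵐ ω ∂μ, multOp hw hA ha f (TimePath.at w k ω) = act (A k ω) (f (TimePath.at w k ω)) :=
  ae_at_of_ae hw (lpMap_coeFn (multLin w A) (stronglyMeasurable_multLin hA) a
    (lintegral_multLin_le hw hA ha) f) k

theorem norm_multOp_le : ‖multOp (μ := μ) (ρ := ρ) hw hA ha‖ ≤ a :=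
  norm_lpMap_le (multLin w A) (stronglyMeasurable_multLin hA) a (lintegral_multLin_le hw hA ha)

/-- The adjoint of multiplication by `A` is multiplication by the transpose. -/
theorem adjoint_multOp_at (f : ProcessSpace μ w ρ p) (k : ℕ) :
    ∀ᵐ ω ∂μ, ContinuousLinearMap.adjoint (multOp (μ := μ) (ρ := ρ) hw hA ha) f
      (TimePath.at w k ω) = act (A k ω).transpose (f (TimePath.at w k ω)) := by
  have hA' : ∀ k i j, Measurable[past w k] fun ω => (A k ω).transpose i j := fun k i j => hA k j i
  have ha' : ∀ k, ∀ᵐ ω ∂μ, matNorm (A k ω).transpose ≤ a := fun k => by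
    simpa only [matNorm_transpose] using ha k
  have : ContinuousLinearMap.adjoint (multOp (μ := μ) (ρ := ρ) hw hA ha) = multOp hw hA' ha' := by
    refine ((ContinuousLinearMap.eq_adjoint_iff _ _).2 fun f g => ?_).symm
    refine (hasSum_inner_processSpace hw _ _).unique ?_
    convert hasSum_inner_processSpace hw f (multOp hw hA ha g) using 3 with k
    refine integral_congr_ae ?_
    filter_upwards [multOp_at hw hA ha g k, multOp_at hw hA' ha' f k] with ω h1 h2
    rw [h1, h2, inner_act_left, Matrix.transpose_transpose]
  rw [this]
  exact multOp_at hw hA' ha' f k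

end Mult

/-- A sequence `v` of multipliers with `v_k` measurable for `F_k` and `E[v_k^2 | F_{k-1}] = 1`,
the latter in integrated form. -/
structure IsMultiplier (μ : Measure Ω) (w v : ℕ → Ω → ℝ) : Prop where
  measurable : ∀ k, Measurable[past w (k + 1)] (v k)
  lintegral_eq : ∀ k (g : Ω → ℝ≥0∞), Measurable[past w k] g →
    ∫⁻ ω, ‖v k ω‖ₑ ^ 2 * g ω ∂μ = ∫⁻ ω, g ω ∂μ

/-- The weighted shift `f ↦ (0, v_0 f_0, v_1 f_1, …)`, as a process. -/
def shiftFun (v : ℕ → Ω → ℝ) {d : ℕ} (f : TimePath w → EuclideanSpace ℝ (Fin d)) :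
    ℕ → Ω → EuclideanSpace ℝ (Fin d)
  | 0, _ => 0
  | k + 1, ω => v k ω • f (TimePath.at w k ω)

/-- The weighted shift as a linear map of functions. -/
def shiftLin (w v : ℕ → Ω → ℝ) (d : ℕ) :
    (TimePath w → EuclideanSpace ℝ (Fin d)) →ₗ[ℝ] (TimePath w → EuclideanSpace ℝ (Fin d)) where
  toFun f := uncurried w (shiftFun v f)
  map_add' f g := by
    funext ⟨k, ω⟩
    cases k with
    | zero => exact (add_zero (0 : EuclideanSpace ℝ (Fin d))).symm
    | succ k => exact smul_add (v k ω) _ _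
  map_smul' c f := by
    funext ⟨k, ω⟩
    cases k with
    | zero => exact (smul_zero (A := EuclideanSpace ℝ (Fin d)) c).symm
    | succ k => exact smul_comm (v k ω) c (f (TimePath.at w k ω))

section Shift

variable (hw : ∀ k, Measurable (w k)) {v : ℕ → Ω → ℝ} (hv : IsMultiplier μ w v) {d : ℕ}

include hv in
theorem stronglyMeasurable_shiftLin (f : TimePath w → EuclideanSpace ℝ (Fin d))
    (hf : StronglyMeasurable f) : StronglyMeasurable (shiftLin w v d f) := by
  refine stronglyMeasurable_timePath.2 fun k => ?_
  cases k with
  | zero => exact measurable_const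
  | succ k =>
    have h1 := hv.measurable k
    have h2 := (stronglyMeasurable_timePath.1 hf k).mono (past_mono k.le_succ) le_rfl
    exact h1.smul h2

include hw hv in
theorem lintegral_shiftLin_le (f : TimePath w → EuclideanSpace ℝ (Fin d))
    (hf : StronglyMeasurable f) :
    ∫⁻ b, ‖shiftLin w v d f b‖ₑ ^ 2 ∂discounted μ w ρ ≤
      (NNReal.sqrt (Real.toNNReal (Real.exp (-ρ))) : ℝ≥0∞) ^ 2 *
        ∫⁻ b, ‖f b‖ₑ ^ 2 ∂discounted μ w ρ := by
  rw [lintegral_discounted hw ((stronglyMeasurable_shiftLin hv f hf).enorm.pow_const 2),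
    lintegral_discounted hw (hf.enorm.pow_const 2), ← ENNReal.tsum_mul_left,
    tsum_eq_zero_add' ENNReal.summable, ← ENNReal.coe_pow, NNReal.sq_sqrt]
  have h0 : ∫⁻ ω, ‖shiftLin w v d f (TimePath.at w 0 ω)‖ₑ ^ 2 ∂μ = 0 := by
    simp [shiftLin, shiftFun]
  rw [h0, mul_zero, zero_add]
  refine ENNReal.tsum_le_tsum fun k => le_of_eq ?_
  have h1 : ∫⁻ ω, ‖shiftLin w v d f (TimePath.at w (k + 1) ω)‖ₑ ^ 2 ∂μ =
      ∫⁻ ω, ‖f (TimePath.at w k ω)‖ₑ ^ 2 ∂μ := by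
    have h2 : Measurable[past w k] fun ω => ‖f (TimePath.at w k ω)‖ₑ ^ 2 :=
      measurable_timePath.1 (hf.enorm.pow_const 2) k
    rw [← hv.lintegral_eq k _ h2]
    simp [shiftLin, shiftFun, enorm_smul, mul_pow]
  rw [h1, ← mul_assoc]
  congr 1
  change _ = ENNReal.ofReal _ * _
  rw [← ENNReal.ofReal_mul (Real.exp_pos _).le, ← Real.exp_add]
  congr 2
  push_cast
  ring

/-- The weighted shift `(g_k)_k ↦ (0, v_0 g_0, v_1 g_1, …)` on `L^{2,ρ}_F`. -/
def shiftOp (d : ℕ) : ProcessSpace μ w ρ d →L[ℝ] ProcessSpace μ w ρ d :=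
  lpMap (shiftLin w v d) (stronglyMeasurable_shiftLin hv) _ (lintegral_shiftLin_le hw hv)

theorem shiftOp_at (f : ProcessSpace μ w ρ d) (k : ℕ) :
    ∀ᵐ ω ∂μ, shiftOp hw hv d f (TimePath.at w k ω) = shiftFun v f k ω :=
  ae_at_of_ae hw (lpMap_coeFn (shiftLin w v d) (stronglyMeasurable_shiftLin hv) _
    (lintegral_shiftLin_le hw hv) f) k

theorem norm_shiftOp_le : ‖shiftOp (ρ := ρ) hw hv d‖ ≤ Real.sqrt (Real.exp (-ρ)) := by
  refine (norm_lpMap_le (shiftLin w v d) (stronglyMeasurable_shiftLin hv) _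
    (lintegral_shiftLin_le hw hv)).trans (le_of_eq ?_)
  rw [Real.coe_sqrt, Real.coe_toNNReal _ (Real.exp_pos _).le]

end Shift

theorem isMultiplier_one : IsMultiplier μ w fun _ _ => 1 :=
  ⟨fun _ => measurable_const, fun _ _ _ => by simp⟩

/-- The noise is a multiplier: for `g ≥ 0` measurable with respect to `F_{k-1}`,
`E[w_k² g] = E[g]`. -/
theorem IsNoise.isMultiplier [IsFiniteMeasure μ] (h : IsNoise μ w) : IsMultiplier μ w w := by
  refine ⟨measurable_noise_past, fun k g hg => ?_⟩
  have hle := past_le h.measurable k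
  have hwk : Measurable fun ω => ‖w k ω‖ₑ ^ 2 := (h.measurable k).enorm.pow_const 2
  have hint : Integrable (fun ω => w k ω ^ 2) μ := (h.memLp k).integrable_sq
  -- on `F_{k-1}` the measures `w_k² μ` and `μ` agree
  have htrim : (μ.withDensity fun ω => ‖w k ω‖ₑ ^ 2).trim hle = μ.trim hle := by
    refine @Measure.ext _ (past w k) _ _ fun s hs => ?_
    rw [trim_measurableSet_eq hle hs, trim_measurableSet_eq hle hs, withDensity_apply _ (hle s hs)]
    have h1 := setIntegral_condExp hle hint hs
    rw [setIntegral_congr_ae (g := fun _ => (1 : ℝ)) (hle s hs)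
      (by filter_upwards [h.condExp_sq_eq_one k] with ω hω _ using hω)] at h1
    have h2 : ∫⁻ ω in s, ‖w k ω‖ₑ ^ 2 ∂μ = ENNReal.ofReal (∫ ω in s, w k ω ^ 2 ∂μ) := by
      rw [ofReal_integral_eq_lintegral_ofReal hint.integrableOn
        (Filter.Eventually.of_forall fun _ => sq_nonneg _)]
      refine lintegral_congr fun ω => ?_
      rw [← ofReal_norm, ← ENNReal.ofReal_pow (norm_nonneg _), Real.norm_eq_abs, sq_abs]
    rw [h2, ← h1]
    simp [measureReal_def]
  rw [← lintegral_trim hle hg, ← htrim, lintegral_trim hle hg,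
    lintegral_withDensity_eq_lintegral_mul _ hwk (hg.mono hle le_rfl)]
  rfl

end Operators

/-! ### Processes supported at one time, and the adjoint of the shift -/

section Spikes

variable {Ω : Type*} [mΩ : MeasurableSpace Ω] {μ : Measure Ω} {w : ℕ → Ω → ℝ} {ρ : ℝ}
  (hw : ∀ k, Measurable (w k)) {d : ℕ}

omit mΩ in
theorem measurable_single {k : ℕ} {g : Ω → EuclideanSpace ℝ (Fin d)} (hg : Measurable[past w k] g)
    (l : ℕ) : Measurable[past w l] (Pi.single (M := fun _ => Ω → EuclideanSpace ℝ (Fin d)) k g l) := by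
  by_cases h : l = k
  · subst h; simpa using hg
  · rw [Pi.single_eq_of_ne h]; exact measurable_const

theorem isWeightedL2_single {k : ℕ} {g : Ω → EuclideanSpace ℝ (Fin d)}
    (hg : Measurable[past w k] g) (hg2 : MemLp g 2 μ) :
    IsWeightedL2 μ w ρ (Pi.single (M := fun _ => Ω → EuclideanSpace ℝ (Fin d)) k g) := by
  refine ⟨measurable_single hg, ?_⟩
  have h : ∀ ω, ∑' l : ℕ, ENNReal.ofReal (Real.exp (-ρ * l)) *
      ‖Pi.single (M := fun _ => Ω → EuclideanSpace ℝ (Fin d)) k g l ω‖ₑ ^ 2 =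
      ENNReal.ofReal (Real.exp (-ρ * k)) * ‖g ω‖ₑ ^ 2 := fun ω => by
    rw [tsum_eq_single k]
    · simp
    · intro l hl
      simp [Pi.single_eq_of_ne hl]
  simp only [h]
  rw [lintegral_const_mul' _ _ ENNReal.ofReal_ne_top]
  exact ENNReal.mul_lt_top ENNReal.ofReal_lt_top ((memLp_two_iff hg2.1).1 hg2)

include hw in
/-- The inner product with a process supported at time `k`. -/
theorem inner_eq_of_support (F G : ProcessSpace μ w ρ d) (k : ℕ)
    (hG : ∀ l ≠ k, ∀ᵐ ω ∂μ, G (TimePath.at w l ω) = 0) :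
    ⟪F, G⟫_ℝ = Real.exp (-ρ * k) * ∫ ω, ⟪F (TimePath.at w k ω), G (TimePath.at w k ω)⟫_ℝ ∂μ := by
  refine (hasSum_inner_processSpace hw F G).unique (hasSum_single k fun l hl => ?_)
  rw [integral_eq_zero_of_ae, mul_zero]
  filter_upwards [hG l hl] with ω hω
  rw [hω, inner_zero_right, Pi.zero_apply]

theorem IsMultiplier.memLp [IsProbabilityMeasure μ] {v : ℕ → Ω → ℝ} (hv : IsMultiplier μ w v)
    (hw : ∀ k, Measurable (w k)) (k : ℕ) : MemLp (v k) 2 μ := by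
  have hm : Measurable (v k) := (hv.measurable k).mono (past_le hw _) le_rfl
  rw [memLp_two_iff hm.aestronglyMeasurable]
  have := hv.lintegral_eq k (fun _ => 1) measurable_const
  simp only [mul_one, lintegral_const, measure_univ] at this
  rw [this]; exact ENNReal.one_lt_top

/-- The adjoint of the weighted shift is a discounted conditional expectation. -/
theorem adjoint_shiftOp_at [IsProbabilityMeasure μ] {v : ℕ → Ω → ℝ} (hv : IsMultiplier μ w v)
    (Y : ProcessSpace μ w ρ d) (k : ℕ) :
    ∀ᵐ ω ∂μ, ContinuousLinearMap.adjoint (shiftOp hw hv d) Y (TimePath.at w k ω) =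
      Real.exp (-ρ) • (μ[fun ω => v k ω • Y (TimePath.at w (k + 1) ω) | past w k]) ω := by
  have hle := past_le hw k
  have hint : Integrable (fun ω => v k ω • Y (TimePath.at w (k + 1) ω)) μ :=
    memLp_one_iff_integrable.1 ((memLp_at hw Y (k + 1)).smul (hv.memLp hw k))
  have hint' : Integrable (fun ω => Real.exp (-ρ) • v k ω • Y (TimePath.at w (k + 1) ω)) μ :=
    hint.fun_smul (Real.exp (-ρ))
  set Z := ContinuousLinearMap.adjoint (shiftOp hw hv d) Y with hZ
  have hZint : Integrable (fun ω => Z (TimePath.at w k ω)) μ :=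
    (memLp_at hw Z k).integrable one_le_two
  -- pairing with `1_s c` at time `k` identifies the integrals over the sets of `F_{k-1}`
  have key : ∀ s, MeasurableSet[past w k] s →
      ∫ ω in s, Z (TimePath.at w k ω) ∂μ =
        ∫ ω in s, Real.exp (-ρ) • v k ω • Y (TimePath.at w (k + 1) ω) ∂μ := by
    intro s hs
    refine ext_inner_left ℝ fun c => ?_
    rw [← integral_inner hZint.integrableOn, ← integral_inner hint'.integrableOn]
    have hg : Measurable[past w k] (s.indicator fun _ => c) :=
      Measurable.indicator measurable_const hs
    obtain ⟨f, hf⟩ := (isWeightedL2_single (ρ := ρ) hg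
      ((memLp_const c).indicator (hle s hs) : MemLp _ 2 μ)).exists_processSpace hw
    have hf0 : ∀ l ≠ k, ∀ᵐ ω ∂μ, f (TimePath.at w l ω) = 0 := fun l hl => by
      filter_upwards [hf l] with ω hω
      rw [hω, Pi.single_eq_of_ne hl, Pi.zero_apply]
    have hS0 : ∀ l ≠ k + 1, ∀ᵐ ω ∂μ, shiftOp hw hv d f (TimePath.at w l ω) = 0 := fun l hl => by
      cases l with
      | zero => exact shiftOp_at hw hv f 0
      | succ l =>
        filter_upwards [shiftOp_at hw hv f (l + 1), hf0 l (by omega)] with ω h1 h2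
        rw [h1, shiftFun, h2, smul_zero]
    have h1 := inner_eq_of_support hw Z f k hf0
    have h2 := inner_eq_of_support hw Y _ (k + 1) hS0
    rw [hZ, ContinuousLinearMap.adjoint_inner_left, h2, ← hZ] at h1
    rw [← integral_indicator (hle s hs), ← integral_indicator (hle s hs)]
    have e1 : ∫ ω, ⟪Z (TimePath.at w k ω), f (TimePath.at w k ω)⟫_ℝ ∂μ =
        ∫ ω, s.indicator (fun ω => ⟪c, Z (TimePath.at w k ω)⟫_ℝ) ω ∂μ := by
      refine integral_congr_ae ?_
      filter_upwards [hf k] with ω hω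
      rw [hω, Pi.single_eq_same]
      by_cases hωs : ω ∈ s
      · simp [hωs, real_inner_comm]
      · simp [hωs]
    have e2 : ∫ ω, s.indicator (fun ω => ⟪c, Real.exp (-ρ) •
          v k ω • Y (TimePath.at w (k + 1) ω)⟫_ℝ) ω ∂μ =
        Real.exp (-ρ) * ∫ ω, ⟪Y (TimePath.at w (k + 1) ω),
          shiftOp hw hv d f (TimePath.at w (k + 1) ω)⟫_ℝ ∂μ := by
      rw [← integral_const_mul]
      refine integral_congr_ae ?_
      filter_upwards [hf k, shiftOp_at hw hv f (k + 1)] with ω hω h3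
      rw [h3, shiftFun, hω, Pi.single_eq_same]
      by_cases hωs : ω ∈ s
      · simp [hωs, real_inner_comm, inner_smul_right]
      · simp [hωs]
    rw [e2, ← e1]
    have he : Real.exp (-ρ * ((k + 1 : ℕ) : ℝ)) = Real.exp (-ρ * k) * Real.exp (-ρ) := by
      rw [← Real.exp_add]; congr 1; push_cast; ring
    rw [he, mul_assoc] at h1
    exact (mul_left_cancel₀ (Real.exp_pos _).ne' h1).symm
  have h := ae_eq_condExp_of_forall_setIntegral_eq hle (hint.smul (Real.exp (-ρ)))
    (fun s _ _ => hZint.integrableOn) (fun s hs _ => key s hs)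
    (measurable_coe_at Z k).stronglyMeasurable.aestronglyMeasurable
  filter_upwards [h, condExp_smul (μ := μ) (Real.exp (-ρ))
    (fun ω => v k ω • Y (TimePath.at w (k + 1) ω)) (past w k)] with ω h1 h2
  rw [h1]; exact h2

/-- The process equal to `g` at time `0` and vanishing afterwards, for a constant `g`. -/
def initOp [IsProbabilityMeasure μ] (d : ℕ) :
    EuclideanSpace ℝ (Fin d) →L[ℝ] ProcessSpace μ w ρ d :=
  LinearMap.toContinuousLinearMap
    { toFun := fun c => (((isWeightedL2_iff hw).1 (isWeightedL2_single (ρ := ρ) (k := 0)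
        (g := fun _ => c) measurable_const (memLp_const c))).2).toLp _
      map_add' := fun c c' => by
        rw [← MemLp.toLp_add]
        congr 1
        exact congrArg (uncurried w) (Pi.single_add 0 (fun _ : Ω => c) fun _ => c')
      map_smul' := fun r c => by
        rw [RingHom.id_apply, ← MemLp.toLp_const_smul]
        congr 1
        exact congrArg (uncurried w) (Pi.single_smul 0 r (fun _ : Ω => c)) }

theorem initOp_at [IsProbabilityMeasure μ] (c : EuclideanSpace ℝ (Fin d)) (k : ℕ) :
    ∀ᵐ ω ∂μ, initOp (μ := μ) (ρ := ρ) hw d c (TimePath.at w k ω) =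
      if k = 0 then c else 0 := by
  have h := ae_at_of_ae hw (((isWeightedL2_iff hw).1 (isWeightedL2_single (ρ := ρ) (k := 0)
        (g := fun _ => c) measurable_const
        (memLp_const (μ := μ) c))).2).coeFn_toLp k
  filter_upwards [h] with ω hω
  refine hω.trans ?_
  by_cases h : k = 0
  · subst h; simp
  · simp [h]

/-- The adjoint of `initOp` is evaluation at time `0`, written as an expectation. -/
theorem adjoint_initOp [IsProbabilityMeasure μ] (Y : ProcessSpace μ w ρ d) :
    ContinuousLinearMap.adjoint (initOp hw d) Y = ∫ ω, Y (TimePath.at w 0 ω) ∂μ := by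
  refine ext_inner_left ℝ fun c => ?_
  rw [ContinuousLinearMap.adjoint_inner_right, real_inner_comm,
    inner_eq_of_support hw Y (initOp hw d c) 0,
    ← integral_inner ((memLp_at hw Y 0).integrable one_le_two)]
  · simp only [Nat.cast_zero, mul_zero, Real.exp_zero, one_mul]
    refine integral_congr_ae ?_
    filter_upwards [initOp_at (μ := μ) (ρ := ρ) hw c 0] with ω hω
    rw [hω, if_pos rfl, real_inner_comm]
  · intro l hl
    filter_upwards [initOp_at (μ := μ) (ρ := ρ) hw c l] with ω hω
    rw [hω, if_neg hl]

end Spikes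

/-! ### The control problem in the Hilbert space -/

section Bridge

open ContinuousLinearMap

variable {Ω : Type*} [mΩ : MeasurableSpace Ω] {μ : Measure Ω} {w : ℕ → Ω → ℝ}

theorem IsBoundedProcess.ae_le {p q : ℕ} {A : ℕ → Ω → Matrix (Fin p) (Fin q) ℝ}
    (hA : IsBoundedProcess μ w A) (k : ℕ) :
    ∀ᵐ ω ∂μ, matNorm (A k ω) ≤ (supNorm μ A).toNNReal := by
  filter_upwards [ENNReal.ae_le_essSup (μ := μ) fun ω => ENNReal.ofReal (matNorm (A k ω))]
    with ω hω
  have h : ENNReal.ofReal (matNorm (A k ω)) ≤ supNorm μ A :=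
    hω.trans (le_iSup (fun k => essSup (fun ω => ENNReal.ofReal (matNorm (A k ω))) μ) k)
  exact (ENNReal.ofReal_le_iff_le_toReal hA.2.ne).1 h

section Ops

variable {ρ : ℝ} {p q : ℕ} {A C : ℕ → Ω → Matrix (Fin p) (Fin q) ℝ}

/-- Multiplication by a process in `L^∞_F`. -/
def IsBoundedProcess.op (hA : IsBoundedProcess μ w A) (hw : ∀ k, Measurable (w k)) :
    ProcessSpace μ w ρ q →L[ℝ] ProcessSpace μ w ρ p :=
  multOp hw hA.1 hA.ae_le

theorem coe_add_at (hw : ∀ k, Measurable (w k)) {d : ℕ} (f g : ProcessSpace μ w ρ d) (k : ℕ) :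
    ∀ᵐ ω ∂μ, (f + g) (TimePath.at w k ω) = f (TimePath.at w k ω) + g (TimePath.at w k ω) :=
  ae_at_of_ae hw (Lp.coeFn_add f g) k

variable [IsProbabilityMeasure μ] (hw : IsNoise μ w)

/-- The operator `f ↦ (0, A_0 f_0 + w_0 C_0 f_0, A_1 f_1 + w_1 C_1 f_1, …)`. -/
def drivenOp (hA : IsBoundedProcess μ w A) (hC : IsBoundedProcess μ w C) :
    ProcessSpace μ w ρ q →L[ℝ] ProcessSpace μ w ρ p :=
  shiftOp hw.measurable isMultiplier_one p ∘L hA.op hw.measurable +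
    shiftOp hw.measurable hw.isMultiplier p ∘L hC.op hw.measurable

theorem drivenOp_at_zero (hA : IsBoundedProcess μ w A) (hC : IsBoundedProcess μ w C)
    (f : ProcessSpace μ w ρ q) :
    ∀ᵐ ω ∂μ, drivenOp hw hA hC f (TimePath.at w 0 ω) = 0 := by
  filter_upwards [coe_add_at hw.measurable
      (shiftOp hw.measurable isMultiplier_one p (hA.op hw.measurable f))
      (shiftOp hw.measurable hw.isMultiplier p (hC.op hw.measurable f)) 0,
    shiftOp_at hw.measurable isMultiplier_one (hA.op hw.measurable f) 0,
    shiftOp_at hw.measurable hw.isMultiplier (hC.op hw.measurable f) 0] with ω h1 h2 h3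
  refine h1.trans ?_
  rw [h2, h3]
  exact add_zero _

theorem drivenOp_at_succ (hA : IsBoundedProcess μ w A) (hC : IsBoundedProcess μ w C)
    (f : ProcessSpace μ w ρ q) (k : ℕ) :
    ∀ᵐ ω ∂μ, drivenOp hw hA hC f (TimePath.at w (k + 1) ω) =
      act (A k ω) (f (TimePath.at w k ω)) + w k ω • act (C k ω) (f (TimePath.at w k ω)) := by
  filter_upwards [coe_add_at hw.measurable
      (shiftOp hw.measurable isMultiplier_one p (hA.op hw.measurable f))
      (shiftOp hw.measurable hw.isMultiplier p (hC.op hw.measurable f)) (k + 1),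
    shiftOp_at hw.measurable isMultiplier_one (hA.op hw.measurable f) (k + 1),
    shiftOp_at hw.measurable hw.isMultiplier (hC.op hw.measurable f) (k + 1),
    multOp_at hw.measurable hA.1 hA.ae_le f k,
    multOp_at hw.measurable hC.1 hC.ae_le f k] with ω h1 h2 h3 h4 h5
  refine h1.trans ?_
  rw [h2, h3, shiftFun, shiftFun, ← h4, ← h5, one_smul]
  rfl

/-- The process underlying an element of the Hilbert space. -/
def toProcess {d : ℕ} (f : ProcessSpace μ w ρ d) : ℕ → Ω → EuclideanSpace ℝ (Fin d) :=
  fun k ω => f (TimePath.at w k ω)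

/-- The adjoint of `drivenOp` produces the terms `y'` and `z'` of the adjoint equation. -/
theorem adjoint_drivenOp_at (hA : IsBoundedProcess μ w A) (hC : IsBoundedProcess μ w C)
    (Y : ProcessSpace μ w ρ p) (k : ℕ) :
    ∀ᵐ ω ∂μ, adjoint (drivenOp hw hA hC) Y (TimePath.at w k ω) =
      Real.exp (-ρ) • act (A k ω).transpose (yPrime μ w (toProcess Y) k ω) +
        Real.exp (-ρ) • act (C k ω).transpose (zPrime μ w (toProcess Y) k ω) := by
  have e : adjoint (drivenOp hw hA hC) Y =
      adjoint (hA.op hw.measurable) (adjoint (shiftOp hw.measurable isMultiplier_one p) Y) +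
        adjoint (hC.op hw.measurable) (adjoint (shiftOp hw.measurable hw.isMultiplier p) Y) := by
    rw [drivenOp, map_add, adjoint_comp, adjoint_comp]; rfl
  rw [e]
  filter_upwards [coe_add_at hw.measurable
      (adjoint (hA.op hw.measurable) (adjoint (shiftOp hw.measurable isMultiplier_one p) Y))
      (adjoint (hC.op hw.measurable) (adjoint (shiftOp hw.measurable hw.isMultiplier p) Y)) k,
    adjoint_multOp_at hw.measurable hA.1 hA.ae_le
      (adjoint (shiftOp hw.measurable isMultiplier_one p) Y) k,
    adjoint_multOp_at hw.measurable hC.1 hC.ae_le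
      (adjoint (shiftOp hw.measurable hw.isMultiplier p) Y) k,
    adjoint_shiftOp_at hw.measurable isMultiplier_one Y k,
    adjoint_shiftOp_at hw.measurable hw.isMultiplier Y k] with ω h1 h2 h3 h4 h5
  refine h1.trans ?_
  refine congrArg₂ (· + ·) (h2.trans ?_) (h3.trans ?_)
  · rw [h4, act_smul]; simp only [one_smul]; rfl
  · rw [h5, act_smul]; rfl

theorem norm_drivenOp_le (hA : IsBoundedProcess μ w A) (hC : IsBoundedProcess μ w C) :
    ‖drivenOp (ρ := ρ) hw hA hC‖ ≤
      Real.sqrt (Real.exp (-ρ)) * ((supNorm μ A).toNNReal + (supNorm μ C).toNNReal) := by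
  rw [mul_add]
  refine (norm_add_le _ _).trans (add_le_add ?_ ?_)
  · exact (opNorm_comp_le _ _).trans (mul_le_mul (norm_shiftOp_le hw.measurable isMultiplier_one)
      (norm_multOp_le hw.measurable hA.1 hA.ae_le) (norm_nonneg _) (Real.sqrt_nonneg _))
  · exact (opNorm_comp_le _ _).trans (mul_le_mul (norm_shiftOp_le hw.measurable hw.isMultiplier)
      (norm_multOp_le hw.measurable hC.1 hC.ae_le) (norm_nonneg _) (Real.sqrt_nonneg _))

end Ops

/-- Pathwise summation against the discount factors: Fubini for the discounted measure. -/
theorem integrable_tsum_discounted {ρ : ℝ} (hw : ∀ k, Measurable (w k)) {g : TimePath w → ℝ}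
    (hg : Measurable g) (hint : Integrable g (discounted μ w ρ)) :
    (∀ᵐ ω ∂μ, Summable fun k : ℕ => Real.exp (-ρ * k) * g (TimePath.at w k ω)) ∧
      Integrable (fun ω => ∑' k : ℕ, Real.exp (-ρ * k) * g (TimePath.at w k ω)) μ ∧
      ∫ ω, ∑' k : ℕ, Real.exp (-ρ * k) * g (TimePath.at w k ω) ∂μ =
        ∫ a, g a ∂discounted μ w ρ := by
  have hgk : ∀ k, Measurable fun ω => g (TimePath.at w k ω) := fun k =>
    hg.comp (measurable_at hw k)
  have hfin := hint.2
  rw [HasFiniteIntegral, lintegral_discounted hw hg.enorm] at hfin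
  have hF : ∀ k : ℕ, ∫⁻ ω, ‖Real.exp (-ρ * k) * g (TimePath.at w k ω)‖ₑ ∂μ =
      ENNReal.ofReal (Real.exp (-ρ * k)) * ∫⁻ ω, ‖g (TimePath.at w k ω)‖ₑ ∂μ := fun k => by
    rw [← lintegral_const_mul' _ _ ENNReal.ofReal_ne_top]
    refine lintegral_congr fun ω => ?_
    rw [enorm_mul, Real.enorm_of_nonneg (Real.exp_pos _).le]
  have hlt : ∫⁻ ω, ∑' k : ℕ, ‖Real.exp (-ρ * k) * g (TimePath.at w k ω)‖ₑ ∂μ < ∞ := by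
    rw [lintegral_tsum fun k => ((hgk k).const_mul _).enorm.aemeasurable]
    simpa only [hF] using hfin
  have hintk : ∀ k : ℕ, Integrable (fun ω => Real.exp (-ρ * k) * g (TimePath.at w k ω)) μ :=
    fun k => ⟨((hgk k).const_mul _).aestronglyMeasurable,
      (hF k ▸ (ENNReal.le_tsum k).trans_lt hfin : _ < ∞)⟩
  have hsumm : ∀ᵐ ω ∂μ, Summable fun k : ℕ => Real.exp (-ρ * k) * g (TimePath.at w k ω) := by
    filter_upwards [ae_lt_top' (AEMeasurable.tsum fun k =>
      ((hgk k).const_mul _).enorm.aemeasurable) hlt.ne] with ω hω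
    exact Summable.of_norm (by simpa using ENNReal.summable_toReal hω.ne)
  have hnorm := (hasSum_integral_discounted hw hint.norm).summable
  have hsum2 := hasSum_integral_of_summable_integral_norm hintk (by
    refine hnorm.congr fun k => ?_
    rw [← integral_const_mul]
    refine integral_congr_ae (Filter.Eventually.of_forall fun ω => ?_)
    simp)
  refine ⟨hsumm, ⟨?_, ?_⟩, ?_⟩
  · refine aestronglyMeasurable_of_tendsto_ae Filter.atTop (f := fun n ω =>
      ∑ k ∈ Finset.range n, Real.exp (-ρ * k) * g (TimePath.at w k ω))
      (fun n => (Finset.measurable_sum _ fun k _ =>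
        (hgk k).const_mul _).aestronglyMeasurable) ?_
    filter_upwards [hsumm] with ω hω using hω.hasSum.tendsto_sum_nat
  · refine lt_of_le_of_lt (lintegral_mono fun ω => ?_) hlt
    exact enorm_tsum_le_tsum_enorm
  · refine hsum2.unique ?_
    simp only [integral_const_mul]
    exact hasSum_integral_discounted hw hint

end Bridge

section Problem

open ContinuousLinearMap

variable {Ω : Type*} [mΩ : MeasurableSpace Ω] {μ : Measure Ω}
  {w : ℕ → Ω → ℝ} {n m : ℕ} {P : Coeffs Ω n m} {δ : ℝ}

/-- The hypotheses under which the control problem is solved. -/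
structure Coeffs.IsStable (P : Coeffs Ω n m) (μ : Measure Ω) (w : ℕ → Ω → ℝ) (δ : ℝ) :
    Prop where
  noise : IsNoise μ w
  regular : P.IsRegular μ w
  M_posDef : P.M.PosDef
  Q_nonneg : ∀ᵐ ω ∂μ, ∀ k, (P.Q k ω).PosSemidef
  δ_pos : 0 < δ
  R_coercive : ∀ᵐ ω ∂μ, ∀ k, (P.R k ω - δ • (1 : Matrix (Fin m) (Fin m) ℝ)).PosSemidef
  lt_ρ : ENNReal.log (6 * (supNorm μ P.A + supNorm μ P.C) ^ 2) < (P.ρ : EReal)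

/-- The controls of the Hilbert space problem: an initial vector and a control process. -/
abbrev ControlSpace (μ : Measure Ω) (w : ℕ → Ω → ℝ) (ρ : ℝ) (n m : ℕ) : Type _ :=
  WithLp 2 (EuclideanSpace ℝ (Fin n) × ProcessSpace μ w ρ m)

/-- Multiplication by `M` as a bounded operator. -/
def Coeffs.opM (P : Coeffs Ω n m) :
    EuclideanSpace ℝ (Fin n) →L[ℝ] EuclideanSpace ℝ (Fin n) :=
  LinearMap.toContinuousLinearMap (Matrix.toEuclideanLin P.M)

theorem integrable_inner_of_memLp {d : ℕ} {f g : Ω → EuclideanSpace ℝ (Fin d)} (hf : MemLp f 2 μ)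
    (hg : MemLp g 2 μ) : Integrable (fun ω => ⟪f ω, g ω⟫_ℝ) μ := by
  refine (L2.integrable_inner (𝕜 := ℝ) (hf.toLp f) (hg.toLp g)).congr ?_
  filter_upwards [hf.coeFn_toLp, hg.coeFn_toLp] with ω h1 h2
  rw [h1, h2]

namespace Coeffs.IsStable

theorem ae_R_posDef (h : P.IsStable μ w δ) : ∀ᵐ ω ∂μ, ∀ k, (P.R k ω).PosDef := by
  filter_upwards [h.R_coercive] with ω hω k using posDef_of_sub_posSemidef h.δ_pos (hω k)

variable (h : P.IsStable μ w δ)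

/-- Multiplication by the process `Q`. -/
def opQ : ProcessSpace μ w P.ρ n →L[ℝ] ProcessSpace μ w P.ρ n :=
  h.regular.Q_mem.op h.noise.measurable

/-- Multiplication by the process `R`. -/
def opR : ProcessSpace μ w P.ρ m →L[ℝ] ProcessSpace μ w P.ρ m :=
  h.regular.R_mem.op h.noise.measurable

theorem opQ_at (x : ProcessSpace μ w P.ρ n) (k : ℕ) :
    ∀ᵐ ω ∂μ, h.opQ x (TimePath.at w k ω) = act (P.Q k ω) (x (TimePath.at w k ω)) :=
  multOp_at h.noise.measurable h.regular.Q_mem.1 h.regular.Q_mem.ae_le x k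

theorem opR_at (u : ProcessSpace μ w P.ρ m) (k : ℕ) :
    ∀ᵐ ω ∂μ, h.opR u (TimePath.at w k ω) = act (P.R k ω) (u (TimePath.at w k ω)) :=
  multOp_at h.noise.measurable h.regular.R_mem.1 h.regular.R_mem.ae_le u k

theorem opQ_symm (x y : ProcessSpace μ w P.ρ n) : ⟪h.opQ x, y⟫_ℝ = ⟪x, h.opQ y⟫_ℝ := by
  refine (hasSum_inner_processSpace h.noise.measurable _ _).unique ?_
  convert hasSum_inner_processSpace h.noise.measurable x (h.opQ y) using 3 with k
  refine integral_congr_ae ?_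
  filter_upwards [h.opQ_at x k, h.opQ_at y k, h.Q_nonneg] with ω h1 h2 h3
  rw [h1, h2, inner_act_left, transpose_eq_of_posSemidef (h3 k)]

theorem opR_symm (x y : ProcessSpace μ w P.ρ m) : ⟪h.opR x, y⟫_ℝ = ⟪x, h.opR y⟫_ℝ := by
  refine (hasSum_inner_processSpace h.noise.measurable _ _).unique ?_
  convert hasSum_inner_processSpace h.noise.measurable x (h.opR y) using 3 with k
  refine integral_congr_ae ?_
  filter_upwards [h.opR_at x k, h.opR_at y k, h.ae_R_posDef] with ω h1 h2 h3
  rw [h1, h2, inner_act_left, transpose_eq_of_posSemidef (h3 k).posSemidef]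

theorem opQ_nonneg (x : ProcessSpace μ w P.ρ n) : 0 ≤ ⟪h.opQ x, x⟫_ℝ := by
  refine (hasSum_inner_processSpace h.noise.measurable _ _).nonneg fun k => ?_
  refine mul_nonneg (Real.exp_pos _).le (integral_nonneg_of_ae ?_)
  filter_upwards [h.opQ_at x k, h.Q_nonneg] with ω h1 h2
  rw [h1]; exact inner_act_nonneg (h2 k) _

theorem opR_coercive (u : ProcessSpace μ w P.ρ m) : δ * ‖u‖ ^ 2 ≤ ⟪h.opR u, u⟫_ℝ := by
  rw [← real_inner_self_eq_norm_sq]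
  have hw := h.noise.measurable
  refine hasSum_le (fun k => ?_) ((hasSum_inner_processSpace hw u u).mul_left δ)
    (hasSum_inner_processSpace hw (h.opR u) u)
  rw [mul_left_comm]
  refine mul_le_mul_of_nonneg_left ?_ (Real.exp_pos _).le
  rw [← integral_const_mul]
  have hu := memLp_at hw u k
  refine integral_mono_ae ((integrable_inner_of_memLp hu hu).const_mul _)
    (integrable_inner_of_memLp (memLp_at hw (h.opR u) k) hu) ?_
  filter_upwards [h.opR_at u k, h.R_coercive] with ω h1 h2
  rw [h1]
  simp only [real_inner_self_eq_norm_sq]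
  exact inner_act_ge_of_sub_posSemidef (h2 k) _

variable [IsProbabilityMeasure μ]

/-- The discount makes the forward dynamics a strict contraction; `(‖A‖_∞ + ‖C‖_∞)² < e^ρ` would
already be enough. -/
theorem norm_drivenOp_lt_one :
    ‖drivenOp (ρ := P.ρ) h.noise h.regular.A_mem h.regular.C_mem‖ < 1 := by
  refine (norm_drivenOp_le h.noise h.regular.A_mem h.regular.C_mem).trans_lt ?_
  have hA := h.regular.A_mem.2.ne
  have hC := h.regular.C_mem.2.ne
  set a : ℝ := ((supNorm μ P.A).toNNReal : ℝ) with ha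
  set c : ℝ := ((supNorm μ P.C).toNNReal : ℝ) with hc
  have hlt := h.lt_ρ
  have e : 6 * (supNorm μ P.A + supNorm μ P.C) ^ 2 = ENNReal.ofReal (6 * (a + c) ^ 2) := by
    rw [ENNReal.ofReal_mul (by norm_num), ENNReal.ofReal_pow (by positivity),
      ENNReal.ofReal_add (by positivity) (by positivity), ha, hc, ENNReal.ofReal_coe_nnreal,
      ENNReal.ofReal_coe_nnreal, ENNReal.coe_toNNReal hA, ENNReal.coe_toNNReal hC]
    norm_num
  have hρ' : (P.ρ : EReal) = ENNReal.log (ENNReal.ofReal (Real.exp P.ρ)) := by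
    rw [ENNReal.log_ofReal_of_pos (Real.exp_pos _), Real.log_exp]
  rw [e, hρ', ENNReal.log_lt_log_iff, ENNReal.ofReal_lt_ofReal_iff (Real.exp_pos _)] at hlt
  have ha0 : 0 ≤ a := NNReal.coe_nonneg _
  have hc0 : 0 ≤ c := NNReal.coe_nonneg _
  rw [← Real.sqrt_sq (add_nonneg ha0 hc0), ← Real.sqrt_mul (Real.exp_pos _).le,
    Real.sqrt_lt' one_pos, Real.exp_neg, one_pow, inv_mul_lt_one₀ (Real.exp_pos _)]
  nlinarith [sq_nonneg (a + c)]

/-- The free term `(0, b_0 + w_0 σ_0, b_1 + w_1 σ_1, …)` of the state equation. -/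
theorem exists_freeTerm (h : P.IsStable μ w δ) : ∃ f : ProcessSpace μ w P.ρ n,
    (∀ᵐ ω ∂μ, f (TimePath.at w 0 ω) = 0) ∧
      ∀ k, ∀ᵐ ω ∂μ, f (TimePath.at w (k + 1) ω) = P.b k ω + w k ω • P.σ k ω := by
  obtain ⟨b, hb⟩ := h.regular.b_mem.exists_processSpace h.noise.measurable
  obtain ⟨s, hs⟩ := h.regular.σ_mem.exists_processSpace h.noise.measurable
  have hadd := coe_add_at h.noise.measurable
    (shiftOp h.noise.measurable isMultiplier_one n b)
    (shiftOp h.noise.measurable h.noise.isMultiplier n s)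
  refine ⟨shiftOp h.noise.measurable isMultiplier_one n b +
    shiftOp h.noise.measurable h.noise.isMultiplier n s, ?_, fun k => ?_⟩
  · filter_upwards [hadd 0, shiftOp_at h.noise.measurable isMultiplier_one b 0,
      shiftOp_at h.noise.measurable h.noise.isMultiplier s 0] with ω h1 h2 h3
    rw [h1, h2, h3]; exact add_zero _
  · filter_upwards [hadd (k + 1), shiftOp_at h.noise.measurable isMultiplier_one b (k + 1),
      shiftOp_at h.noise.measurable h.noise.isMultiplier s (k + 1), hb k, hs k]
      with ω h1 h2 h3 h4 h5
    rw [h1, h2, h3, shiftFun, shiftFun, h4, h5, one_smul]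

/-- The Hilbert space form of the control problem. -/
def hilbertLQ : HilbertLQ (ProcessSpace μ w P.ρ n) (ControlSpace μ w P.ρ n m) where
  S := drivenOp h.noise h.regular.A_mem h.regular.C_mem
  L := initOp h.noise.measurable n ∘L WithLp.fstL 2 ℝ _ _ +
    drivenOp h.noise h.regular.B_mem h.regular.D_mem ∘L WithLp.sndL 2 ℝ _ _
  Q := h.opQ
  N := (WithLp.prodContinuousLinearEquiv 2 ℝ _ _).symm.toContinuousLinearMap ∘L
    (P.opM.prodMap h.opR) ∘L (WithLp.prodContinuousLinearEquiv 2 ℝ _ _).toContinuousLinearMap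
  f := h.exists_freeTerm.choose
  norm_S_lt := h.norm_drivenOp_lt_one
  Q_symm := h.opQ_symm
  Q_nonneg := h.opQ_nonneg
  N_symm x y := by
    rw [WithLp.prod_inner_apply, WithLp.prod_inner_apply]
    refine congrArg₂ (· + ·) ?_ (h.opR_symm _ _)
    refine (inner_act_left P.M x.fst y.fst).trans ?_
    rw [transpose_eq_of_posSemidef h.M_posDef.posSemidef]
    rfl
  c := min (exists_coercive_of_posDef h.M_posDef).choose δ
  c_pos := lt_min (exists_coercive_of_posDef h.M_posDef).choose_spec.1 h.δ_pos
  N_coercive v := by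
    rw [WithLp.prod_inner_apply, ← real_inner_self_eq_norm_sq, WithLp.prod_inner_apply, mul_add]
    refine add_le_add ?_ ?_
    · rw [real_inner_self_eq_norm_sq]
      exact (mul_le_mul_of_nonneg_right (min_le_left _ _) (sq_nonneg _)).trans
        ((exists_coercive_of_posDef h.M_posDef).choose_spec.2 _)
    · rw [real_inner_self_eq_norm_sq]
      exact (mul_le_mul_of_nonneg_right (min_le_right _ _) (sq_nonneg _)).trans
        (h.opR_coercive _)

theorem inner_N (v : ControlSpace μ w P.ρ n m) :
    ⟪h.hilbertLQ.N v, v⟫_ℝ = ⟪act P.M v.fst, v.fst⟫_ℝ + ⟪h.opR v.snd, v.snd⟫_ℝ :=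
  WithLp.prod_inner_apply _ _

/-- Stationarity splits into the condition on the initial state and that on the control. -/
theorem stationary_iff (v : ControlSpace μ w P.ρ n m) (y : ProcessSpace μ w P.ρ n) :
    h.hilbertLQ.N v + adjoint h.hilbertLQ.L y = 0 ↔
      act P.M v.fst + ∫ ω, y (TimePath.at w 0 ω) ∂μ = 0 ∧
      h.opR v.snd + adjoint (drivenOp h.noise h.regular.B_mem h.regular.D_mem) y = 0 := by
  have key : ∀ v' : ControlSpace μ w P.ρ n m, ⟪h.hilbertLQ.N v + adjoint h.hilbertLQ.L y, v'⟫_ℝ =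
      ⟪act P.M v.fst + ∫ ω, y (TimePath.at w 0 ω) ∂μ, v'.fst⟫_ℝ +
      ⟪h.opR v.snd + adjoint (drivenOp h.noise h.regular.B_mem h.regular.D_mem) y, v'.snd⟫_ℝ := by
    intro v'
    have e1 : ⟪h.hilbertLQ.N v, v'⟫_ℝ = ⟪act P.M v.fst, v'.fst⟫_ℝ + ⟪h.opR v.snd, v'.snd⟫_ℝ :=
      WithLp.prod_inner_apply _ _
    have e2 : h.hilbertLQ.L v' = initOp h.noise.measurable n v'.fst +
      drivenOp h.noise h.regular.B_mem h.regular.D_mem v'.snd := rfl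
    rw [inner_add_left, e1, adjoint_inner_left, e2, inner_add_right, inner_add_left, inner_add_left,
      ← adjoint_initOp h.noise.measurable, adjoint_inner_left, adjoint_inner_left]
    ring
  constructor
  · intro h0
    simp only [h0, inner_zero_left] at key
    constructor
    · refine ext_inner_right ℝ fun ξ => ?_
      simpa using (key (WithLp.toLp 2 (ξ, 0))).symm
    · refine ext_inner_right ℝ fun u => ?_
      simpa using (key (WithLp.toLp 2 (0, u))).symm
  · rintro ⟨h1, h2⟩
    refine ext_inner_right ℝ fun v' => ?_
    rw [key, h1, h2, inner_zero_left, inner_zero_left, inner_zero_left, add_zero]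

theorem state_rhs_at_zero (x : ProcessSpace μ w P.ρ n) (v : ControlSpace μ w P.ρ n m) :
    ∀ᵐ ω ∂μ, (h.hilbertLQ.S x + h.hilbertLQ.L v + h.hilbertLQ.f) (TimePath.at w 0 ω) = v.fst := by
  have hw := h.noise.measurable
  have e2 : h.hilbertLQ.L v = initOp h.noise.measurable n v.fst +
      drivenOp h.noise h.regular.B_mem h.regular.D_mem v.snd := rfl
  filter_upwards [coe_add_at hw (h.hilbertLQ.S x + h.hilbertLQ.L v) h.hilbertLQ.f 0,
    coe_add_at hw (h.hilbertLQ.S x) (h.hilbertLQ.L v) 0,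
    coe_add_at hw (initOp h.noise.measurable n v.fst)
      (drivenOp h.noise h.regular.B_mem h.regular.D_mem v.snd) 0,
    drivenOp_at_zero h.noise h.regular.A_mem h.regular.C_mem x,
    drivenOp_at_zero h.noise h.regular.B_mem h.regular.D_mem v.snd,
    initOp_at (μ := μ) (ρ := P.ρ) hw v.fst 0, h.exists_freeTerm.choose_spec.1]
    with ω h1 h2 h3 h4 h5 h6 h7
  rw [h1, h2, e2, h3, h5, h6]
  -- unfolds the fields `S` and `f` of `hilbertLQ`
  erw [h4, h7]
  simp

theorem state_rhs_at_succ (x : ProcessSpace μ w P.ρ n) (v : ControlSpace μ w P.ρ n m) (k : ℕ) :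
    ∀ᵐ ω ∂μ, (h.hilbertLQ.S x + h.hilbertLQ.L v + h.hilbertLQ.f) (TimePath.at w (k + 1) ω) =
      P.step w k ω (toProcess x k ω) (toProcess v.snd k ω) := by
  have hw := h.noise.measurable
  have e2 : h.hilbertLQ.L v = initOp h.noise.measurable n v.fst +
      drivenOp h.noise h.regular.B_mem h.regular.D_mem v.snd := rfl
  filter_upwards [coe_add_at hw (h.hilbertLQ.S x + h.hilbertLQ.L v) h.hilbertLQ.f (k + 1),
    coe_add_at hw (h.hilbertLQ.S x) (h.hilbertLQ.L v) (k + 1),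
    coe_add_at hw (initOp h.noise.measurable n v.fst)
      (drivenOp h.noise h.regular.B_mem h.regular.D_mem v.snd) (k + 1),
    drivenOp_at_succ h.noise h.regular.A_mem h.regular.C_mem x k,
    drivenOp_at_succ h.noise h.regular.B_mem h.regular.D_mem v.snd k,
    initOp_at (μ := μ) (ρ := P.ρ) hw v.fst (k + 1), h.exists_freeTerm.choose_spec.2 k]
    with ω h1 h2 h3 h4 h5 h6 h7
  rw [h1, h2, e2, h3, h5, h6]
  -- unfolds the fields `S` and `f` of `hilbertLQ`
  erw [h4, h7]
  simp only [Coeffs.step, toProcess, Nat.add_eq_zero_iff, one_ne_zero, and_false, if_false,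
    smul_add]
  abel

/-- The state equation in the Hilbert space is the recursion defining the state process. -/
theorem state_iff (x : ProcessSpace μ w P.ρ n) (v : ControlSpace μ w P.ρ n m) :
    x = h.hilbertLQ.S x + h.hilbertLQ.L v + h.hilbertLQ.f ↔
      (∀ᵐ ω ∂μ, toProcess x 0 ω = v.fst) ∧
      ∀ k, ∀ᵐ ω ∂μ, toProcess x (k + 1) ω =
        P.step w k ω (toProcess x k ω) (toProcess v.snd k ω) := by
  constructor
  · intro hx
    refine ⟨?_, fun k => ?_⟩
    · filter_upwards [h.state_rhs_at_zero x v] with ω hω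
      rwa [← hx] at hω
    · filter_upwards [h.state_rhs_at_succ x v k] with ω hω
      rwa [← hx] at hω
  · rintro ⟨h0, h1⟩
    refine ext_processSpace h.noise.measurable fun k => ?_
    cases k with
    | zero =>
      filter_upwards [h0, h.state_rhs_at_zero x v] with ω h2 h3
      rw [h3]; exact h2
    | succ k =>
      filter_upwards [h1 k, h.state_rhs_at_succ x v k] with ω h2 h3
      rw [h3]; exact h2

/-- The adjoint equation in the Hilbert space is the backward equation. -/
theorem adj_iff (x y : ProcessSpace μ w P.ρ n) :
    y = adjoint h.hilbertLQ.S y + h.hilbertLQ.Q x ↔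
      ∀ k, ∀ᵐ ω ∂μ, toProcess y k ω =
        Real.exp (-P.ρ) • act (P.A k ω).transpose (yPrime μ w (toProcess y) k ω) +
          Real.exp (-P.ρ) • act (P.C k ω).transpose (zPrime μ w (toProcess y) k ω) +
          act (P.Q k ω) (toProcess x k ω) := by
  have key : ∀ k, ∀ᵐ ω ∂μ, (adjoint h.hilbertLQ.S y + h.hilbertLQ.Q x) (TimePath.at w k ω) =
      Real.exp (-P.ρ) • act (P.A k ω).transpose (yPrime μ w (toProcess y) k ω) +
        Real.exp (-P.ρ) • act (P.C k ω).transpose (zPrime μ w (toProcess y) k ω) +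
        act (P.Q k ω) (toProcess x k ω) := fun k => by
    filter_upwards [coe_add_at h.noise.measurable (adjoint h.hilbertLQ.S y) (h.hilbertLQ.Q x) k,
      adjoint_drivenOp_at h.noise h.regular.A_mem h.regular.C_mem y k, h.opQ_at x k]
      with ω h1 h2 h3
    exact h1.trans (congrArg₂ (· + ·) h2 h3)
  constructor
  · intro hy k
    filter_upwards [key k] with ω hω
    rwa [← hy] at hω
  · intro hy
    refine ext_processSpace h.noise.measurable fun k => ?_
    filter_upwards [key k, hy k] with ω h1 h2
    rw [h1]; exact h2

/-- Stationarity in the control process, written out at each time. -/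
theorem control_iff (u : ProcessSpace μ w P.ρ m) (y : ProcessSpace μ w P.ρ n) :
    h.opR u + adjoint (drivenOp h.noise h.regular.B_mem h.regular.D_mem) y = 0 ↔
      ∀ k, ∀ᵐ ω ∂μ, 0 =
        Real.exp (-P.ρ) • act (P.B k ω).transpose (yPrime μ w (toProcess y) k ω) +
          Real.exp (-P.ρ) • act (P.D k ω).transpose (zPrime μ w (toProcess y) k ω) +
          act (P.R k ω) (toProcess u k ω) := by
  have key : ∀ k, ∀ᵐ ω ∂μ, (h.opR u + adjoint (drivenOp h.noise h.regular.B_mem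
      h.regular.D_mem) y) (TimePath.at w k ω) =
      Real.exp (-P.ρ) • act (P.B k ω).transpose (yPrime μ w (toProcess y) k ω) +
        Real.exp (-P.ρ) • act (P.D k ω).transpose (zPrime μ w (toProcess y) k ω) +
        act (P.R k ω) (toProcess u k ω) := fun k => by
    filter_upwards [coe_add_at h.noise.measurable (h.opR u)
        (adjoint (drivenOp h.noise h.regular.B_mem h.regular.D_mem) y) k,
      adjoint_drivenOp_at h.noise h.regular.B_mem h.regular.D_mem y k, h.opR_at u k]
      with ω h1 h2 h3
    exact h1.trans ((add_comm _ _).trans (congrArg₂ (· + ·) h2 h3))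
  have hzero := ae_at_of_ae h.noise.measurable
    (Lp.coeFn_zero (EuclideanSpace ℝ (Fin m)) 2 (discounted μ w P.ρ))
  constructor
  · intro hy k
    filter_upwards [key k, hzero k] with ω hω h0
    rw [hy, h0] at hω
    exact hω
  · intro hy
    refine ext_processSpace h.noise.measurable fun k => ?_
    filter_upwards [key k, hy k, hzero k] with ω h1 h2 h3
    rw [h1, h3]; exact h2.symm

end Coeffs.IsStable
end Problem

/-! ### Transfer between processes and the Hilbert space -/

section Transfer

open ContinuousLinearMap

variable {Ω : Type*} [mΩ : MeasurableSpace Ω] {μ : Measure Ω}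
  {w : ℕ → Ω → ℝ} {n m : ℕ} {P : Coeffs Ω n m} {δ : ℝ}

theorem IsWeightedL2.congr {ρ : ℝ} {d : ℕ} {g g' : ℕ → Ω → EuclideanSpace ℝ (Fin d)}
    (hg : IsWeightedL2 μ w ρ g) (hm : ∀ k, Measurable[past w k] (g' k))
    (h : ∀ k, g k =ᵐ[μ] g' k) : IsWeightedL2 μ w ρ g' := by
  refine ⟨hm, lt_of_eq_of_lt (lintegral_congr_ae ?_) hg.2⟩
  filter_upwards [ae_all_iff.2 h] with ω hω
  simp only [hω]

omit mΩ in
/-- `F_{-1}` is trivial, so measurable vectors are constant. -/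
theorem eq_const_of_measurable_past_zero {d : ℕ} {g : Ω → EuclideanSpace ℝ (Fin d)}
    (hg : Measurable[past w 0] g) : ∃ c, ∀ ω, g ω = c := by
  have h0 : past w 0 = ⊥ := by simp [past]
  rw [h0] at hg
  obtain ⟨c, hc⟩ := eq_const_of_measurable_bot hg
  exact ⟨c, fun ω => congrFun hc ω⟩

theorem yPrime_congr {y y' : ℕ → Ω → EuclideanSpace ℝ (Fin n)} (h : ∀ k, y k =ᵐ[μ] y' k) (k : ℕ) :
    yPrime μ w y k =ᵐ[μ] yPrime μ w y' k :=
  condExp_congr_ae (h (k + 1))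

theorem zPrime_congr {y y' : ℕ → Ω → EuclideanSpace ℝ (Fin n)} (h : ∀ k, y k =ᵐ[μ] y' k) (k : ℕ) :
    zPrime μ w y k =ᵐ[μ] zPrime μ w y' k := by
  refine condExp_congr_ae ?_
  filter_upwards [h (k + 1)] with ω hω
  rw [hω]

/-- Being a solution of the Hamiltonian system only depends on almost sure classes. -/
theorem Coeffs.IsHamiltonianSolution.congr {x y x' y' : ℕ → Ω → EuclideanSpace ℝ (Fin n)}
    {u u' : ℕ → Ω → EuclideanSpace ℝ (Fin m)} (h : P.IsHamiltonianSolution μ w x y u)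
    (hx' : IsWeightedL2 μ w P.ρ x') (hy' : IsWeightedL2 μ w P.ρ y')
    (hu' : IsWeightedL2 μ w P.ρ u') (hx : ∀ k, x k =ᵐ[μ] x' k) (hy : ∀ k, y k =ᵐ[μ] y' k)
    (hu : ∀ k, u k =ᵐ[μ] u' k) : P.IsHamiltonianSolution μ w x' y' u' where
  x_mem := hx'
  y_mem := hy'
  u_mem := hu'
  forward k := by
    filter_upwards [h.forward k, hx k, hx (k + 1), hu k] with ω h1 h2 h3 h4
    rw [← h2, ← h3, ← h4, h1]
  backward k := by
    filter_upwards [h.backward k, hx k, hy k, yPrime_congr (w := w) hy k,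
      zPrime_congr (w := w) hy k] with ω h1 h2 h3 h4 h5
    rw [← h2, ← h3, ← h4, ← h5, h1]
  initial := by
    filter_upwards [h.initial, hx 0, hy 0] with ω h1 h2 h3
    rw [← h2, ← h3, h1]
  stationary k := by
    filter_upwards [h.stationary k, hu k, yPrime_congr (w := w) hy k,
      zPrime_congr (w := w) hy k] with ω h1 h2 h4 h5
    rw [← h2, ← h4, ← h5, ← h1]

theorem toProcess_mem {ρ : ℝ} (hw : ∀ k, Measurable (w k)) {d : ℕ} (f : ProcessSpace μ w ρ d) :
    IsWeightedL2 μ w ρ (toProcess f) :=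
  (isWeightedL2_iff hw).2 ⟨Lp.stronglyMeasurable f, Lp.memLp f⟩

theorem toProcess_zero_eq_integral {ρ : ℝ} [IsProbabilityMeasure μ] {d : ℕ}
    (f : ProcessSpace μ w ρ d) (ω : Ω) :
    toProcess f 0 ω = ∫ ω', f (TimePath.at w 0 ω') ∂μ := by
  obtain ⟨c, hc⟩ := eq_const_of_measurable_past_zero (measurable_coe_at f 0)
  simp only [hc, integral_const, probReal_univ, one_smul]
  exact hc ω

theorem measurable_step_past {k : ℕ} (hP : P.IsRegular μ w) {x : Ω → EuclideanSpace ℝ (Fin n)}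
    {u : Ω → EuclideanSpace ℝ (Fin m)} (hx : Measurable[past w k] x) (hu : Measurable[past w k] u) :
    Measurable[past w (k + 1)] fun ω => P.step w k ω (x ω) (u ω) := by
  have hle : past w k ≤ past w (k + 1) := past_mono k.le_succ
  have h1 : Measurable[past w k] fun ω =>
      act (P.A k ω) (x ω) + act (P.B k ω) (u ω) + P.b k ω :=
    ((measurable_act (hP.A_mem.1 k) hx).add (measurable_act (hP.B_mem.1 k) hu)).add (hP.b_mem.1 k)
  have h2 : Measurable[past w k] fun ω =>
      act (P.C k ω) (x ω) + act (P.D k ω) (u ω) + P.σ k ω :=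
    ((measurable_act (hP.C_mem.1 k) hx).add (measurable_act (hP.D_mem.1 k) hu)).add (hP.σ_mem.1 k)
  exact (h1.mono hle le_rfl).add ((measurable_noise_past k).smul (h2.mono hle le_rfl))

theorem measurable_state_past (hP : P.IsRegular μ w) {ξ : Ω → EuclideanSpace ℝ (Fin n)}
    {u : ℕ → Ω → EuclideanSpace ℝ (Fin m)} (hξ : Measurable[past w 0] ξ)
    (hu : ∀ k, Measurable[past w k] (u k)) (k : ℕ) : Measurable[past w k] (P.state w ξ u k) := by
  induction k with
  | zero => exact hξ
  | succ k ih => exact measurable_step_past hP ih (hu k)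

theorem measurable_yPrime (y : ℕ → Ω → EuclideanSpace ℝ (Fin n)) (k : ℕ) :
    Measurable[past w k] (yPrime μ w y k) :=
  (stronglyMeasurable_condExp (m := past w k) (μ := μ) (f := y (k + 1))).measurable

theorem measurable_zPrime (y : ℕ → Ω → EuclideanSpace ℝ (Fin n)) (k : ℕ) :
    Measurable[past w k] (zPrime μ w y k) :=
  (stronglyMeasurable_condExp (m := past w k) (μ := μ)
    (f := fun ω => w k ω • y (k + 1) ω)).measurable

theorem measurable_candidateControl (hP : P.IsRegular μ w)
    (y : ℕ → Ω → EuclideanSpace ℝ (Fin n)) (k : ℕ) :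
    Measurable[past w k] (P.candidateControl μ w y k) := by
  have hy := measurable_act (mX := past w k) (fun i j => hP.B_mem.1 k j i)
    (measurable_yPrime (μ := μ) y k)
  have hz := measurable_act (mX := past w k) (fun i j => hP.D_mem.1 k j i)
    (measurable_zPrime (μ := μ) y k)
  have hR : ∀ i j, Measurable[past w k] fun ω => (P.R k ω)⁻¹ i j :=
    measurable_inv_apply (hP.R_mem.1 k)
  exact (measurable_act (mX := past w k) hR
    ((hy.fun_const_smul (Real.exp (-P.ρ))).fun_add (hz.fun_const_smul (Real.exp (-P.ρ))))).fun_neg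

namespace Coeffs.IsStable

variable [IsProbabilityMeasure μ] (h : P.IsStable μ w δ)

include h

theorem exists_state (v : ControlSpace μ w P.ρ n m) :
    ∃ x, x = h.hilbertLQ.S x + h.hilbertLQ.L v + h.hilbertLQ.f := by
  obtain ⟨x, hx⟩ := exists_eq_contraction_add h.hilbertLQ.norm_S_lt
    (h.hilbertLQ.L v + h.hilbertLQ.f)
  exact ⟨x, by rwa [add_assoc]⟩

omit [IsProbabilityMeasure μ] in
/-- An admissible pair is an element of the control space: its initial state is constant. -/
theorem exists_control {ξ : Ω → EuclideanSpace ℝ (Fin n)} {u : ℕ → Ω → EuclideanSpace ℝ (Fin m)}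
    (hadm : P.IsAdmissible μ w ξ u) : ∃ v : ControlSpace μ w P.ρ n m,
      (∀ᵐ ω ∂μ, ξ ω = v.fst) ∧ ∀ k, ∀ᵐ ω ∂μ, toProcess v.snd k ω = u k ω := by
  obtain ⟨c, hc⟩ := eq_const_of_measurable_past_zero hadm.1.1
  obtain ⟨U, hU⟩ := hadm.2.exists_processSpace h.noise.measurable
  exact ⟨WithLp.toLp 2 (c, U), Filter.Eventually.of_forall hc, hU⟩

section Control

variable {ξ : Ω → EuclideanSpace ℝ (Fin n)} {u : ℕ → Ω → EuclideanSpace ℝ (Fin m)}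
  {v : ControlSpace μ w P.ρ n m} {x : ProcessSpace μ w P.ρ n}
  (hξ : ∀ᵐ ω ∂μ, ξ ω = v.fst) (hu : ∀ k, ∀ᵐ ω ∂μ, toProcess v.snd k ω = u k ω)
  (hx : x = h.hilbertLQ.S x + h.hilbertLQ.L v + h.hilbertLQ.f)

include hξ hu hx

theorem toProcess_ae_eq_state (k : ℕ) :
    ∀ᵐ ω ∂μ, toProcess x k ω = P.state w ξ u k ω := by
  obtain ⟨h0, h1⟩ := (h.state_iff x v).1 hx
  induction k with
  | zero =>
    filter_upwards [h0, hξ] with ω h2 h3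
    rw [h2, Coeffs.state, h3]
  | succ k ih =>
    filter_upwards [h1 k, ih, hu k] with ω h2 h3 h4
    rw [h2, Coeffs.state, h3, h4]

/-- The cost of a control is finite and is given by the quadratic form of the Hilbert space
problem. -/
theorem cost_eq :
    (∀ᵐ ω ∂μ, Summable fun k => P.runningCost w ξ u k ω) ∧ Integrable (P.pathCost w ξ u) μ ∧
      P.cost μ w ξ u = (1 / 2) * (⟪h.hilbertLQ.N v, v⟫_ℝ + ⟪h.hilbertLQ.Q x, x⟫_ℝ) := by
  have hQi := L2.integrable_inner (𝕜 := ℝ) (h.opQ x) x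
  have hRi := L2.integrable_inner (𝕜 := ℝ) (h.opR v.snd) v.snd
  obtain ⟨h1, h2, h3⟩ := integrable_tsum_discounted h.noise.measurable
    (((Lp.stronglyMeasurable (h.opQ x)).inner (Lp.stronglyMeasurable x)).add
      ((Lp.stronglyMeasurable (h.opR v.snd)).inner (Lp.stronglyMeasurable v.snd))).measurable
    (hQi.add hRi)
  have hrun : ∀ᵐ ω ∂μ, ∀ k : ℕ, Real.exp (-P.ρ * k) *
      ((fun a => ⟪h.opQ x a, x a⟫_ℝ) + fun a => ⟪h.opR v.snd a, v.snd a⟫_ℝ)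
        (TimePath.at w k ω) = P.runningCost w ξ u k ω := by
    refine ae_all_iff.2 fun k => ?_
    filter_upwards [h.opQ_at x k, h.opR_at v.snd k, h.toProcess_ae_eq_state hξ hu hx k, hu k]
      with ω e1 e2 e3 e4
    rw [toProcess] at e3 e4
    rw [Pi.add_apply, e1, e2, e3, e4]
    rfl
  have hpath : (fun ω => ⟪act P.M v.fst, v.fst⟫_ℝ + ∑' k : ℕ, Real.exp (-P.ρ * k) *
      ((fun a => ⟪h.opQ x a, x a⟫_ℝ) + fun a => ⟪h.opR v.snd a, v.snd a⟫_ℝ)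
        (TimePath.at w k ω)) =ᵐ[μ] P.pathCost w ξ u := by
    filter_upwards [hrun, hξ] with ω e1 e2
    rw [Coeffs.pathCost, e2]
    simp only [e1]
  refine ⟨?_, ((integrable_const _).add h2).congr hpath, ?_⟩
  · filter_upwards [h1, hrun] with ω e1 e2
    simpa only [e2] using e1
  · rw [Coeffs.cost, ← integral_congr_ae hpath, integral_add (integrable_const _) h2, h3,
      integral_const, h.inner_N]
    have e4 : ⟪h.hilbertLQ.Q x, x⟫_ℝ = ∫ a, ⟪h.opQ x a, x a⟫_ℝ ∂discounted μ w P.ρ :=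
      L2.inner_def _ _
    rw [e4, L2.inner_def]
    have e5 := integral_add hQi hRi
    simp only [Pi.add_apply, probReal_univ, one_smul]
    rw [e5]
    ring

end Control

/-- The Hamiltonian system is the optimality system of the Hilbert space problem. -/
theorem isHamiltonianSolution_iff (x y : ProcessSpace μ w P.ρ n) (u : ProcessSpace μ w P.ρ m) :
    P.IsHamiltonianSolution μ w (toProcess x) (toProcess y) (toProcess u) ↔
      h.hilbertLQ.IsSolution x y
        (WithLp.toLp 2 (-act P.M⁻¹ (∫ ω, y (TimePath.at w 0 ω) ∂μ), u)) := by
  have hw := h.noise.measurable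
  constructor
  · intro H
    refine ⟨(h.state_iff _ _).2 ⟨?_, H.forward⟩, (h.adj_iff _ _).2 H.backward,
      (h.stationary_iff _ _).2 ⟨?_, (h.control_iff _ _).2 H.stationary⟩⟩
    · filter_upwards [H.initial] with ω hω
      rw [hω, toProcess_zero_eq_integral]
      rfl
    · change act P.M (-act P.M⁻¹ _) + _ = 0
      rw [act_neg, act_act_inv h.M_posDef, neg_add_cancel]
  · intro H
    obtain ⟨h0, h1⟩ := (h.state_iff _ _).1 H.state
    obtain ⟨-, h2⟩ := (h.stationary_iff _ _).1 H.stat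
    refine ⟨toProcess_mem hw x, toProcess_mem hw y, toProcess_mem hw u, h1,
      (h.adj_iff _ _).1 H.adj, ?_, (h.control_iff _ _).1 h2⟩
    filter_upwards [h0] with ω hω
    rw [hω, toProcess_zero_eq_integral]
    rfl

theorem exists_isHamiltonianSolution : ∃ x y u, P.IsHamiltonianSolution μ w x y u := by
  obtain ⟨x, y, v, H⟩ := h.hilbertLQ.exists_isSolution
  refine ⟨toProcess x, toProcess y, toProcess v.snd, (h.isHamiltonianSolution_iff _ _ _).2 ?_⟩
  have hv := ((h.stationary_iff _ _).1 H.stat).1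
  have : v.fst = -act P.M⁻¹ (∫ ω, y (TimePath.at w 0 ω) ∂μ) := by
    rw [← inv_act_act h.M_posDef v.fst, eq_neg_of_add_eq_zero_left hv, act_neg]
  rw [← this]
  exact H

/-- Every solution of the Hamiltonian system comes from the Hilbert space, with initial control
`-M⁻¹ y_0`. -/
theorem exists_isSolution_of_isHamiltonianSolution {x y : ℕ → Ω → EuclideanSpace ℝ (Fin n)}
    {u : ℕ → Ω → EuclideanSpace ℝ (Fin m)} (H : P.IsHamiltonianSolution μ w x y u) :
    ∃ (X Y : ProcessSpace μ w P.ρ n) (v : ControlSpace μ w P.ρ n m),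
      h.hilbertLQ.IsSolution X Y v ∧ (∀ k, toProcess X k =ᵐ[μ] x k) ∧
        (∀ k, toProcess Y k =ᵐ[μ] y k) ∧ (∀ k, toProcess v.snd k =ᵐ[μ] u k) ∧
        ∀ᵐ ω ∂μ, P.candidateState y ω = v.fst := by
  have hw := h.noise.measurable
  obtain ⟨X, hX⟩ := H.x_mem.exists_processSpace hw
  obtain ⟨Y, hY⟩ := H.y_mem.exists_processSpace hw
  obtain ⟨U, hU⟩ := H.u_mem.exists_processSpace hw
  have H' : P.IsHamiltonianSolution μ w (toProcess X) (toProcess Y) (toProcess U) :=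
    H.congr (toProcess_mem hw X) (toProcess_mem hw Y) (toProcess_mem hw U)
      (fun k => Filter.EventuallyEq.symm (hX k)) (fun k => Filter.EventuallyEq.symm (hY k))
      (fun k => Filter.EventuallyEq.symm (hU k))
  refine ⟨X, Y, _, (h.isHamiltonianSolution_iff X Y U).1 H', hX, hY, hU, ?_⟩
  filter_upwards [hY 0] with ω hω
  rw [Coeffs.candidateState, ← hω, ← toProcess_zero_eq_integral Y ω]
  rfl

omit [IsProbabilityMeasure μ] in
/-- `R` is invertible, so stationarity determines the control. -/
theorem ae_eq_candidateControl {x y : ℕ → Ω → EuclideanSpace ℝ (Fin n)}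
    {u : ℕ → Ω → EuclideanSpace ℝ (Fin m)} (H : P.IsHamiltonianSolution μ w x y u) (k : ℕ) :
    u k =ᵐ[μ] P.candidateControl μ w y k := by
  filter_upwards [H.stationary k, h.ae_R_posDef] with ω h1 h2
  rw [Coeffs.candidateControl, eq_neg_of_add_eq_zero_left h1.symm, act_neg, neg_neg,
    inv_act_act (h2 k)]

theorem isAdmissible_candidate {x y : ℕ → Ω → EuclideanSpace ℝ (Fin n)}
    {u : ℕ → Ω → EuclideanSpace ℝ (Fin m)} (H : P.IsHamiltonianSolution μ w x y u) :
    P.IsAdmissible μ w (P.candidateState y) (P.candidateControl μ w y) := by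
  have h0 : Measurable[past w 0] fun ω => act P.M⁻¹ (y 0 ω) :=
    measurable_act (mX := past w 0) (fun _ _ => measurable_const) (H.y_mem.1 0)
  have hm : Measurable[past w 0] (P.candidateState y) := h0.fun_neg
  refine ⟨⟨hm, ?_⟩, H.u_mem.congr (measurable_candidateControl h.regular y)
    (h.ae_eq_candidateControl H)⟩
  obtain ⟨c, hc⟩ := eq_const_of_measurable_past_zero hm
  rw [funext hc]
  exact memLp_const c

/-- The candidate pair has the classes of the stationary control, so `cost_add_le` compares its cost
with all others and forces equality for a second minimizer. -/
theorem isOptimal_candidate {x y : ℕ → Ω → EuclideanSpace ℝ (Fin n)}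
    {u : ℕ → Ω → EuclideanSpace ℝ (Fin m)} (H : P.IsHamiltonianSolution μ w x y u) :
    P.IsOptimal μ w (P.candidateState y) (P.candidateControl μ w y) ∧
      ∀ ζ v, P.IsOptimal μ w ζ v →
        ζ =ᵐ[μ] P.candidateState y ∧ ∀ k, v k =ᵐ[μ] P.candidateControl μ w y k := by
  obtain ⟨X, Y, V, hsol, -, -, hU, hξ⟩ := h.exists_isSolution_of_isHamiltonianSolution H
  have hUc : ∀ k, toProcess V.snd k =ᵐ[μ] P.candidateControl μ w y k := fun k =>
    (hU k).trans (h.ae_eq_candidateControl H k)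
  have hcost := (h.cost_eq hξ hUc hsol.state).2.2
  have hadm := h.isAdmissible_candidate H
  refine ⟨⟨hadm, fun ζ v hv => ?_⟩, fun ζ v hv => ?_⟩
  · obtain ⟨V', hζ, hV'⟩ := h.exists_control hv
    obtain ⟨X', hX'⟩ := h.exists_state V'
    rw [hcost, (h.cost_eq hζ hV' hX').2.2]
    have := hsol.cost_add_le hX'
    have := mul_nonneg h.hilbertLQ.c_pos.le (sq_nonneg ‖V' - V‖)
    linarith
  · obtain ⟨V', hζ, hV'⟩ := h.exists_control hv.1
    obtain ⟨X', hX'⟩ := h.exists_state V'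
    have hle := hv.2 _ _ hadm
    rw [hcost, (h.cost_eq hζ hV' hX').2.2] at hle
    have h1 := hsol.cost_add_le hX'
    have h2 : h.hilbertLQ.c * ‖V' - V‖ ^ 2 ≤ 0 := by linarith
    have h3 : ‖V' - V‖ ^ 2 ≤ 0 := nonpos_of_mul_nonpos_right h2 h.hilbertLQ.c_pos
    have h4 : V' = V := sub_eq_zero.1 (norm_eq_zero.1 (pow_eq_zero_iff two_ne_zero |>.1
      (le_antisymm h3 (sq_nonneg _))))
    subst h4
    refine ⟨?_, fun k => ?_⟩
    · filter_upwards [hζ, hξ] with ω e1 e2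
      rw [e1, e2]
    · filter_upwards [hV' k, hUc k] with ω e1 e2
      rw [← e1, ← e2]

end Coeffs.IsStable
end Transfer

end ForwardLQ

end

theorem mainTheorem6 {Ω : Type*} [MeasurableSpace Ω] (μ : Measure Ω) [IsProbabilityMeasure μ]
    (w : ℕ → Ω → ℝ) (hw : ForwardLQ.IsNoise μ w)
    {n m : ℕ} (P : ForwardLQ.Coeffs Ω n m) (hP : P.IsRegular μ w)
    (hM : P.M.PosDef)
    (hQ : ∀ᵐ ω ∂μ, ∀ k, (P.Q k ω).PosSemidef)
    (δ : ℝ) (hδ : 0 < δ)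
    (hR : ∀ᵐ ω ∂μ, ∀ k, (P.R k ω - δ • (1 : Matrix (Fin m) (Fin m) ℝ)).PosSemidef)
    (hρ : ENNReal.log (6 * (ForwardLQ.supNorm μ P.A + ForwardLQ.supNorm μ P.C) ^ 2)
      < (P.ρ : EReal)) :
    -- the control problem is well posed: states are in `L^{2,ρ}` and costs are finite
    (∀ ξ u, P.IsAdmissible μ w ξ u →
      ForwardLQ.IsWeightedL2 μ w P.ρ (P.state w ξ u) ∧
      (∀ᵐ ω ∂μ, Summable fun k => P.runningCost w ξ u k ω) ∧
      Integrable (P.pathCost w ξ u) μ) ∧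
    -- the Hamiltonian system has a solution
    (∃ x y u, P.IsHamiltonianSolution μ w x y u) ∧
    -- the solution is unique
    (∀ x y u x' y' u', P.IsHamiltonianSolution μ w x y u →
      P.IsHamiltonianSolution μ w x' y' u' →
      ∀ k, x k =ᵐ[μ] x' k ∧ y k =ᵐ[μ] y' k ∧ u k =ᵐ[μ] u' k) ∧
    -- it gives the optimal pair, which is unique
    (∀ x y u, P.IsHamiltonianSolution μ w x y u →
      (∀ k, u k =ᵐ[μ] P.candidateControl μ w y k) ∧
      P.IsOptimal μ w (P.candidateState y) (P.candidateControl μ w y) ∧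
      ∀ ζ v, P.IsOptimal μ w ζ v →
        ζ =ᵐ[μ] P.candidateState y ∧ ∀ k, v k =ᵐ[μ] P.candidateControl μ w y k) := by

  have h : P.IsStable μ w δ := ⟨hw, hP, hM, hQ, hδ, hR, hρ⟩
  refine ⟨fun ξ u hadm => ?_, h.exists_isHamiltonianSolution, ?_, fun x y u H =>
    ⟨h.ae_eq_candidateControl H, h.isOptimal_candidate H⟩⟩
  · obtain ⟨v, hξ, hu⟩ := h.exists_control hadm
    obtain ⟨X, hX⟩ := h.exists_state v
    obtain ⟨h1, h2, -⟩ := h.cost_eq hξ hu hX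
    exact ⟨(ForwardLQ.toProcess_mem hw.measurable X).congr
      (ForwardLQ.measurable_state_past hP hadm.1.1 hadm.2.1) (h.toProcess_ae_eq_state hξ hu hX),
      h1, h2⟩
  · intro x y u x' y' u' H H' k
    obtain ⟨X, Y, V, hsol, hX, hY, hV, -⟩ := h.exists_isSolution_of_isHamiltonianSolution H
    obtain ⟨X', Y', V', hsol', hX', hY', hV', -⟩ := h.exists_isSolution_of_isHamiltonianSolution H'
    obtain ⟨rfl, rfl, rfl⟩ := hsol.unique hsol'
    exact ⟨(hX k).symm.trans (hX' k), (hY k).symm.trans (hY' k), (hV k).symm.trans (hV' k)⟩
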